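/- **Setting.** Let $(\Omega,\mathcal F)$ be a measurable space and let $\mathscr H$ be a linear space of real $\mathcal F$-measurable functions on $\Omega$ such that $\varphi(X_1,\dots,X_n)\in\mathscr H$ whenever $X_1,\dots,X_n\in\mathscr H$ and $\varphi\in C_{l,Lip}(\mathbb R^n)$, i.e. $|\varphi(x)-\varphi(y)|\le C(1+|x|^m+|y|^m)|x-y|$ for some $C>0$, $m\in\mathbb N$. Let $\widehat{\mathbb E}:\mathscr H\to[-\infty,\infty]$ be a sub-linear expectation: it is monotone, $\widehat{\mathbb E}[c]=c$ for constants $c$, $\widehat{\mathbb E}[X+Y]\le\widehat{\mathbb E}[X]+\widehat{\mathbb E}[Y]$ whenever the right-hand side is not of the form $\infty-\infty$ or $-\infty+\infty$, and $\widehat{\mathbb E}[\lambda X]=\lambda\widehat{\mathbb E}[X]$ for $\lambda\ge0$ (with $0\cdot\infty=0$). A sequence $Y_1,Y_2,\dots\in\mathscr H$ is identically distributed if $\widehat{\mathbb E}[\varphi(Y_i)]=\widehat{\mathbb E}[\varphi(Y_1)]$ for all $i$ and all bounded Lipschitz $\varphi:\mathbb R\to\mathbb R$. It is independent if for every $k\ge1$,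 with $X=(Y_1,\dots,Y_k)$, one has $\widehat{\mathbb E}[\varphi(X,Y_{k+1})]=\widehat{\mathbb E}\big[\widehat{\mathbb E}[\varphi(x,Y_{k+1})]\big|_{x=X}\big]$ for every $\varphi\in C_{l,Lip}(\mathbb R^k\times\mathbb R)$ such that $\overline\varphi(x):=\widehat{\mathbb E}[|\varphi(x,Y_{k+1})|]<\infty$ for all $x$ and $\widehat{\mathbb E}[\overline\varphi(X)]<\infty$ (where the functions of $X$ under the outer expectations belong to $\mathscr H$). Let $\mathbb V$ be a sub-additive capacity on $\mathcal F$, that is, $\mathbb V:\mathcal F\to[0,1]$ is monotone with $\mathbb V(\emptyset)=0$, $\mathbb V(\Omega)=1$, $\mathbb V(A\cup B)\le\mathbb V(A)+\mathbb V(B)$, such that $\widehat{\mathbb E}[f]\le\mathbb V(A)\le\widehat{\mathbb E}[g]$ whenever $f\le I_A\le g$, $f,g\in\mathscr H$, $A\in\mathcal F$. Its Choquet integral is $C_{\mathbb V}[X]=\int_0^\infty\mathbb V(X\ge t)\,dt+\int_{-\infty}^0[\mathbb V(X\ge t)-1]\,dt$. Put $$\widehat{\mathbb V}(A)=\inf\{\widehat{\mathbb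 E}[\xi]:I_A\le\xi,\ \xi\in\mathscr H\},\qquad \widehat{\mathbb V}^{*}(A)=\inf\Big\{\sum_{n=1}^\infty\widehat{\mathbb V}(A_n):A\subset\bigcup_{n=1}^\infty A_n,\ A_n\in\mathcal F\Big\}.$$ For $X\in\mathscr H$ let $\breve{\mathbb E}[X]=\lim_{c\to\infty}\widehat{\mathbb E}[(-c)\vee(X\wedge c)]$ when the limit exists in $[-\infty,\infty]$. Write $\log x=\ln\max(e,x)$. **Theorem.** Let $\{Y_n;n\ge1\}$ be independent and identically distributed random variables in $(\Omega,\mathscr H,\widehat{\mathbb E})$ with $$C_{\mathbb V}\left[\frac{Y_1^2}{\log\log|Y_1|}\right]<\infty .$$ Then $\breve{\mathbb E}[Y_i]$ and $\breve{\mathbb E}[-Y_i]$ exist, are finite and do not depend on $i$; the limits $\overline\sigma_2^2=\breve{\mathbb E}[(Y_1-\breve{\mathbb E}[Y_1])^2]$ and $\overline\sigma_1^2=\breve{\mathbb E}[(Y_1+\breve{\mathbb E}[-Y_1])^2]$ exist in $[0,\infty]$; and, with $\overline\sigma_1,\overline\sigma_2\in[0,\infty]$ their square roots, $$\widehat{\mathbb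 V}^{*}\left(\liminf_{n\to\infty}\frac{\sum_{i=1}^n(Y_i+\breve{\mathbb E}[-Y_i])}{\sqrt{2n\log\log n}}<-\overline\sigma_1\ \text{ or }\ \limsup_{n\to\infty}\frac{\sum_{i=1}^n(Y_i-\breve{\mathbb E}[Y_i])}{\sqrt{2n\log\log n}}>\overline\sigma_2\right)=0 .$$ -/

import Mathlib

open Filter Topology MeasureTheory Set
open scoped ENNReal

/-- The class `C_{l,Lip}(F)`: functions with
`|φ x - φ y| ≤ C (1 + |x|^m + |y|^m) |x - y|` for some `C > 0` and `m ∈ ℕ`.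
On `Fin n → ℝ` the norm is the supremum norm; as all norms on `ℝⁿ` are equivalent, the class
is the same as for the Euclidean norm. -/
def LocLip {F : Type*} [SeminormedAddCommGroup F] (φ : F → ℝ) : Prop :=
  ∃ C : ℝ, 0 < C ∧ ∃ m : ℕ, ∀ x y : F,
    |φ x - φ y| ≤ C * (1 + ‖x‖ ^ m + ‖y‖ ^ m) * ‖x - y‖

/-- The class `C_{b,Lip}(F)` of bounded Lipschitz functions. -/
def BddLip {F : Type*} [SeminormedAddCommGroup F] (φ : F → ℝ) : Prop :=
  (∃ M : ℝ, ∀ x, |φ x| ≤ M) ∧ ∃ L : ℝ, ∀ x y, |φ x - φ y| ≤ L * ‖x - y‖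

theorem LocLip.abs {F : Type*} [SeminormedAddCommGroup F] {φ : F → ℝ} (h : LocLip φ) :
    LocLip (fun x => |φ x|) := by
  obtain ⟨C, hC, m, h⟩ := h
  exact ⟨C, hC, m, fun x y => (abs_abs_sub_abs_le_abs_sub _ _).trans (h x y)⟩

theorem LocLip.of_lipschitz {F : Type*} [SeminormedAddCommGroup F] {φ : F → ℝ}
    (h : ∀ x y, |φ x - φ y| ≤ ‖x - y‖) : LocLip φ := by
  refine ⟨1, one_pos, 0, fun x y => (h x y).trans ?_⟩
  have := norm_nonneg (x - y)
  simp only [pow_zero]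
  linarith

/-- Freezing the first block of variables keeps a function in `C_{l,Lip}`. -/
theorem LocLip.append_left {m n : ℕ} {φ : (Fin (m + n) → ℝ) → ℝ} (h : LocLip φ)
    (x : Fin m → ℝ) : LocLip (fun y : Fin n → ℝ => φ (Fin.append x y)) := by
  obtain ⟨C, hC, k, h⟩ := h
  have hn : ∀ y : Fin n → ℝ, ‖Fin.append x y‖ ≤ ‖x‖ + ‖y‖ := by
    intro y
    refine (pi_norm_le_iff_of_nonneg (by positivity)).2 fun i => ?_
    refine Fin.addCases (fun j => ?_) (fun j => ?_) i
    · rw [Fin.append_left]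
      exact (norm_le_pi_norm x j).trans (by linarith [norm_nonneg y])
    · rw [Fin.append_right]
      exact (norm_le_pi_norm y j).trans (by linarith [norm_nonneg x])
  have hd : ∀ y z : Fin n → ℝ, ‖Fin.append x y - Fin.append x z‖ ≤ ‖y - z‖ := by
    intro y z
    refine (pi_norm_le_iff_of_nonneg (norm_nonneg _)).2 fun i => ?_
    refine Fin.addCases (fun j => ?_) (fun j => ?_) i
    · simp
    · simpa using norm_le_pi_norm (y - z) j
  set A : ℝ := ‖x‖ ^ k with hA
  set K : ℝ := 2 ^ (k - 1) with hK
  have hA0 : 0 ≤ A := by positivity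
  have hK0 : 0 < K := by positivity
  have hp : ∀ y : Fin n → ℝ, ‖Fin.append x y‖ ^ k ≤ K * (A + ‖y‖ ^ k) := fun y =>
    (pow_le_pow_left₀ (norm_nonneg _) (hn y) k).trans
      (add_pow_le (norm_nonneg _) (norm_nonneg _) k)
  refine ⟨C * (1 + 2 * K * A + K), by positivity, k, fun y z => (h _ _).trans ?_⟩
  have h1 : 1 + ‖Fin.append x y‖ ^ k + ‖Fin.append x z‖ ^ k
      ≤ (1 + 2 * K * A + K) * (1 + ‖y‖ ^ k + ‖z‖ ^ k) := by
    have hy : 0 ≤ ‖y‖ ^ k := by positivity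
    have hz : 0 ≤ ‖z‖ ^ k := by positivity
    have hKA : 0 ≤ K * A := by positivity
    nlinarith [hp y, hp z, mul_nonneg hKA hy, mul_nonneg hKA hz]
  calc C * (1 + ‖Fin.append x y‖ ^ k + ‖Fin.append x z‖ ^ k) *
        ‖Fin.append x y - Fin.append x z‖
      ≤ C * ((1 + 2 * K * A + K) * (1 + ‖y‖ ^ k + ‖z‖ ^ k)) * ‖y - z‖ := by
        gcongr
        exact hd y z
    _ = _ := by ring

theorem LocLip.trunc (c : ℝ) : LocLip (fun x : ℝ => max (-c) (min x c)) := by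
  refine LocLip.of_lipschitz fun x y => ?_
  refine (abs_max_sub_max_le_max _ _ _ _).trans ?_
  simp only [sub_self, abs_zero]
  refine max_le (norm_nonneg _) ((abs_min_sub_min_le_max _ _ _ _).trans ?_)
  simp [Real.norm_eq_abs]

theorem LocLip.sub_sq (a : ℝ) : LocLip (fun x : ℝ => (x - a) ^ 2) := by
  refine ⟨1 + 2 * |a|, by positivity, 1, fun x y => ?_⟩
  have h1 : (x - a) ^ 2 - (y - a) ^ 2 = (x + y - 2 * a) * (x - y) := by ring
  have h2 : |x + y - 2 * a| ≤ |x| + |y| + 2 * |a| := by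
    have := abs_sub (x + y) (2 * a)
    have h3 := abs_add_le x y
    rw [abs_mul, abs_two] at this
    linarith
  simp only [h1, abs_mul, Real.norm_eq_abs, pow_one]
  gcongr
  nlinarith [abs_nonneg x, abs_nonneg y, abs_nonneg a,
    mul_nonneg (abs_nonneg a) (abs_nonneg x), mul_nonneg (abs_nonneg a) (abs_nonneg y)]

/-- A sub-linear expectation space `(Ω, H, E)`: a linear space `H` of real measurable functions
that is stable under `C_{l,Lip}` functions of finitely many of its members, together with a
sub-linear expectation `E : H → [-∞, ∞]`. -/
structure SubLinSpace (Ω : Type*) [MeasurableSpace Ω] where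
  H : Submodule ℝ (Ω → ℝ)
  measurable_of_mem : ∀ X ∈ H, Measurable X
  comp_mem : ∀ {n : ℕ} (φ : (Fin n → ℝ) → ℝ), LocLip φ →
    ∀ X : Fin n → H, (fun ω => φ (fun i => (X i : Ω → ℝ) ω)) ∈ H
  E : H → EReal
  /-- monotonicity -/
  mono : ∀ X Y : H, (∀ ω, (Y : Ω → ℝ) ω ≤ (X : Ω → ℝ) ω) → E Y ≤ E X
  /-- preservation of constants -/
  const : ∀ (X : H) (c : ℝ), (∀ ω, (X : Ω → ℝ) ω = c) → E X = (c : EReal)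
  /-- sub-additivity, whenever the right-hand side is not `∞ - ∞` or `-∞ + ∞` -/
  subadd : ∀ X Y : H, ¬ (E X = ⊤ ∧ E Y = ⊥) → ¬ (E X = ⊥ ∧ E Y = ⊤) →
    E (X + Y) ≤ E X + E Y
  /-- positive homogeneity (with `0 * ∞ = 0`) -/
  homog : ∀ (X : H) (r : ℝ), 0 ≤ r → E (r • X) = (r : EReal) * E X

namespace SubLinSpace

variable {Ω : Type*} [MeasurableSpace Ω]

/-- `φ(X₁, …, Xₙ)` as an element of `H`. -/
def comp (S : SubLinSpace Ω) {n : ℕ} (φ : (Fin n → ℝ) → ℝ) (hφ : LocLip φ) (X : Fin n → S.H) :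
    S.H :=
  ⟨fun ω => φ (fun i => (X i : Ω → ℝ) ω), S.comp_mem φ hφ X⟩

theorem comp₁_mem (S : SubLinSpace Ω) (φ : ℝ → ℝ) (hφ : LocLip φ) (X : S.H) :
    (fun ω => φ ((X : Ω → ℝ) ω)) ∈ S.H := by
  refine S.comp_mem (n := 1) (fun x => φ (x 0)) ?_ (fun _ => X)
  obtain ⟨C, hC, m, h⟩ := hφ
  refine ⟨C, hC, m, fun x y => (h _ _).trans ?_⟩
  have hd : ‖x 0 - y 0‖ ≤ ‖x - y‖ := norm_le_pi_norm (x - y) 0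
  have hx := norm_le_pi_norm x 0
  have hy := norm_le_pi_norm y 0
  gcongr

theorem _root_.BddLip.locLip {F : Type*} [SeminormedAddCommGroup F] {φ : F → ℝ} (h : BddLip φ) :
    LocLip φ := by
  obtain ⟨-, L, h⟩ := h
  refine ⟨|L| + 1, by positivity, 0, fun x y => (h x y).trans ?_⟩
  simp only [pow_zero]
  gcongr
  linarith [le_abs_self L, abs_nonneg L]

/-- `φ(X)` as an element of `H`, for a function `φ` of one real variable. -/
def comp₁ (S : SubLinSpace Ω) (φ : ℝ → ℝ) (hφ : LocLip φ) (X : S.H) : S.H :=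
  ⟨fun ω => φ ((X : Ω → ℝ) ω), S.comp₁_mem φ hφ X⟩

/-- `X` and `Z` are identically distributed: `E[φ(X)] = E[φ(Z)]` for all `φ ∈ C_{b,Lip}(ℝ)`. -/
def IdentDistrib (S : SubLinSpace Ω) (X Z : S.H) : Prop :=
  ∀ (φ : ℝ → ℝ) (hφ : BddLip φ),
    S.E (S.comp₁ φ (BddLip.locLip hφ) X) = S.E (S.comp₁ φ (BddLip.locLip hφ) Z)

/-- The random vector `Y` is independent to the random vector `X`: for all
`φ ∈ C_{l,Lip}(ℝᵐ × ℝⁿ)`, `E[φ(X, Y)] = E[ E[φ(x, Y)]|_{x = X} ]` whenever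
`φ̄(x) := E|φ(x, Y)| < ∞` for all `x` and `E[φ̄(X)] < ∞`.
The two functions of `X` inside the outer expectations are real-valued under the first
proviso; the identity is required when they belong to the domain `H` of `E`. -/
def IndepTo (S : SubLinSpace Ω) {m n : ℕ} (Y : Fin n → S.H) (X : Fin m → S.H) : Prop :=
  ∀ (φ : (Fin (m + n) → ℝ) → ℝ) (hφ : LocLip φ),
    (∀ x : Fin m → ℝ,
      S.E (S.comp (fun y => |φ (Fin.append x y)|) (hφ.append_left x).abs Y) < ⊤) →
    ∀ (hbar : (fun ω => (S.E (S.comp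
          (fun y => |φ (Fin.append (fun i => (X i : Ω → ℝ) ω) y)|)
          (hφ.append_left (fun i => (X i : Ω → ℝ) ω)).abs Y)).toReal) ∈ S.H)
      (hin : (fun ω => (S.E (S.comp
          (fun y => φ (Fin.append (fun i => (X i : Ω → ℝ) ω) y))
          (hφ.append_left (fun i => (X i : Ω → ℝ) ω)) Y)).toReal) ∈ S.H),
      S.E ⟨_, hbar⟩ < ⊤ →
      S.E (S.comp φ hφ (Fin.append X Y)) = S.E ⟨_, hin⟩

/-- Independence of a sequence (the sequence is `Y 0, Y 1, …`): each `Y (k + 1)` is independent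
to `(Y 0, …, Y k)`. -/
def IndepSeq (S : SubLinSpace Ω) (Y : ℕ → S.H) : Prop :=
  ∀ k : ℕ, S.IndepTo (fun _ : Fin 1 => Y (k + 1)) (fun j : Fin (k + 1) => Y j)

/-- `V` (a function on events, only its values on measurable sets matter) is a sub-additive
capacity with `E[f] ≤ V(A) ≤ E[g]` whenever `f ≤ I_A ≤ g`, `f, g ∈ H`, `A` measurable. -/
structure IsUpperCapacity (S : SubLinSpace Ω) (V : Set Ω → ℝ) : Prop where
  nonneg : ∀ A, MeasurableSet A → 0 ≤ V A
  le_one : ∀ A, MeasurableSet A → V A ≤ 1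
  empty : V ∅ = 0
  univ : V Set.univ = 1
  mono : ∀ A B, MeasurableSet A → MeasurableSet B → A ⊆ B → V A ≤ V B
  subadd : ∀ A B, MeasurableSet A → MeasurableSet B → V (A ∪ B) ≤ V A + V B
  sandwich : ∀ (f g : S.H) (A : Set Ω), MeasurableSet A →
    (∀ ω, (f : Ω → ℝ) ω ≤ A.indicator (fun _ => (1 : ℝ)) ω) →
    (∀ ω, A.indicator (fun _ => (1 : ℝ)) ω ≤ (g : Ω → ℝ) ω) →
    S.E f ≤ (V A : EReal) ∧ (V A : EReal) ≤ S.E g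

/-- The largest such capacity, `inf {E[ξ] : I_A ≤ ξ, ξ ∈ H}`. -/
noncomputable def upCap (S : SubLinSpace Ω) (A : Set Ω) : EReal :=
  sInf {e : EReal | ∃ ξ : S.H,
    (∀ ω, A.indicator (fun _ => (1 : ℝ)) ω ≤ (ξ : Ω → ℝ) ω) ∧ e = S.E ξ}

/-- The countably sub-additive extension
`V̂*(A) = inf {∑ₙ upCap(Aₙ) : A ⊆ ⋃ₙ Aₙ, Aₙ measurable}`.
As `0 ≤ upCap ≤ 1`, the conversion to `[0, ∞]` loses nothing. -/
noncomputable def outerCap (S : SubLinSpace Ω) (A : Set Ω) : ℝ≥0∞ :=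
  sInf {s : ℝ≥0∞ | ∃ B : ℕ → Set Ω, (∀ n, MeasurableSet (B n)) ∧ A ⊆ ⋃ n, B n ∧
    s = ∑' n, (S.upCap (B n)).toENNReal}

/-- The truncation `(-c) ∨ X ∧ c`. -/
def trunc (S : SubLinSpace Ω) (c : ℝ) (X : S.H) : S.H :=
  S.comp₁ (fun x => max (-c) (min x c)) (LocLip.trunc c) X

/-- `(X - a)²` as an element of `H`. -/
def subSq (S : SubLinSpace Ω) (a : ℝ) (X : S.H) : S.H :=
  S.comp₁ (fun x => (x - a) ^ 2) (LocLip.sub_sq a) X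

/-- `Ĕ[X]` exists and equals `l ∈ [-∞, ∞]`, where `Ĕ[X] = lim_{c → ∞} E[(-c) ∨ X ∧ c]`. -/
def HasTruncMean (S : SubLinSpace Ω) (X : S.H) (l : EReal) : Prop :=
  Tendsto (fun c : ℝ => S.E (S.trunc c X)) atTop (𝓝 l)

end SubLinSpace

/-- The Choquet integral
`C_V[X] = ∫_0^∞ V(X ≥ t) dt + ∫_{-∞}^0 (V(X ≥ t) - 1) dt`; for `X ≥ 0` and `V(Ω) = 1` the
second integral vanishes. -/
noncomputable def choquet {Ω : Type*} (V : Set Ω → ℝ) (X : Ω → ℝ) : EReal :=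
  ((∫⁻ t in Set.Ioi (0 : ℝ), ENNReal.ofReal (V {ω | t ≤ X ω}) : ℝ≥0∞) : EReal) -
    ((∫⁻ t in Set.Iio (0 : ℝ), ENNReal.ofReal (1 - V {ω | t ≤ X ω}) : ℝ≥0∞) : EReal)

/-- `log x = ln (max e x)`. -/
noncomputable def plog (x : ℝ) : ℝ := Real.log (max (Real.exp 1) x)

/-- The norming constant `√(2 n log log n)`. -/
noncomputable def lilNorm (n : ℕ) : ℝ := Real.sqrt (2 * n * plog (plog n))

/-! It suffices to prove the upper half: after centring at the limiting truncated mean, the limsup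
is at most the limiting standard deviation σ off a null set of `outerCapMeasure`. The lower half is
the same statement for `-Y`, and an infinite σ leaves nothing to prove.

Independence only speaks of locally Lipschitz test functions, so it is used through the one-step
inequality `StepLaw`, and Lipschitz cutoffs replace indicators and stopping times. A potential that
dominates a smoothed indicator of the running maximum, and whose expectation does not increase in
time, gives a Chernoff bound for maxima of partial sums (`StepLaw.ev_pmax_le`). The variables are
truncated at a small multiple of √(n log log n) and the exponential is expanded to third order: the
quadratic term keeps the sharp Gaussian rate and the rest costs a third moment. Choosing the
exponent well (`le_of_forall_le_exp`) leaves a constant times τ + exp(-κ log log n), where τ is a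
normalised third moment and κ > 1 because the level exceeds σ.

Along n = i 2ᴶ these bounds are summable. The Gaussian terms are O(J^(-κ)). The Choquet condition
gives ∑ 2ʲ V(|Y| ≥ c `scale j`) < ∞, which controls the truncated-off events, the third moments
(`SummableTails.summable_cube`) and the error in the mean (`SummableTails.exists_truncMean_close`).
Borel-Cantelli treats each i, and finitely many i interpolate between powers of two
(`StepLaw.outerCapMeasure_limsup`). -/

/-! ### Calculus of bounded Lipschitz functions. -/

section BddLipCalculus

variable {F G : Type*} [SeminormedAddCommGroup F] [SeminormedAddCommGroup G]

theorem BddLip.of_lipschitzWith {φ : F → ℝ} {K : NNReal} (hL : LipschitzWith K φ) {M : ℝ}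
    (hM : ∀ x, |φ x| ≤ M) : BddLip φ := by
  refine ⟨⟨M, hM⟩, K, fun x y => ?_⟩
  simpa [Real.dist_eq, dist_eq_norm] using hL.dist_le_mul x y

theorem BddLip.exists_lipschitzWith {φ : F → ℝ} (h : BddLip φ) : ∃ K, LipschitzWith K φ := by
  obtain ⟨-, L, h⟩ := h
  refine ⟨L.toNNReal, LipschitzWith.of_dist_le_mul fun x y => ?_⟩
  rw [Real.dist_eq, dist_eq_norm]
  refine (h x y).trans ?_
  gcongr
  exact Real.le_coe_toNNReal L

theorem BddLip.const (c : ℝ) : BddLip (fun _ : F => c) :=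
  ⟨⟨|c|, fun _ => le_rfl⟩, 0, fun x y => by simp⟩

theorem BddLip.comp {φ : F → ℝ} (h : BddLip φ) {f : G → F} {K : NNReal} (hf : LipschitzWith K f) :
    BddLip (fun x => φ (f x)) := by
  obtain ⟨K', hK'⟩ := h.exists_lipschitzWith
  obtain ⟨⟨M, hM⟩, -⟩ := h
  exact BddLip.of_lipschitzWith (hK'.comp hf) (fun x => hM _)

theorem BddLip.add {φ ψ : F → ℝ} (h : BddLip φ) (h' : BddLip ψ) :
    BddLip (fun x => φ x + ψ x) := by
  obtain ⟨⟨M, hM⟩, L, hL⟩ := h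
  obtain ⟨⟨M', hM'⟩, L', hL'⟩ := h'
  refine ⟨⟨M + M', fun x => (abs_add_le _ _).trans (add_le_add (hM x) (hM' x))⟩, L + L',
    fun x y => ?_⟩
  rw [add_sub_add_comm, add_mul]
  exact (abs_add_le _ _).trans (add_le_add (hL x y) (hL' x y))

theorem BddLip.mul {φ ψ : F → ℝ} (h : BddLip φ) (h' : BddLip ψ) :
    BddLip (fun x => φ x * ψ x) := by
  obtain ⟨⟨M, hM⟩, L, hL⟩ := h
  obtain ⟨⟨M', hM'⟩, L', hL'⟩ := h'
  refine ⟨⟨M * M', fun x => ?_⟩, M * L' + L * M', fun x y => ?_⟩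
  · rw [abs_mul]
    exact mul_le_mul (hM x) (hM' x) (abs_nonneg _) ((abs_nonneg _).trans (hM x))
  · have e : φ x * ψ x - φ y * ψ y = φ x * (ψ x - ψ y) + (φ x - φ y) * ψ y := by ring
    rw [e]
    refine (abs_add_le _ _).trans ?_
    rw [abs_mul, abs_mul]
    have h1 := mul_le_mul (hM x) (hL' x y) (abs_nonneg _) ((abs_nonneg _).trans (hM x))
    have h2 := mul_le_mul (hL x y) (hM' y) (abs_nonneg _) ((abs_nonneg _).trans (hL x y))
    linarith [h1, h2]

theorem BddLip.const_mul {φ : F → ℝ} (h : BddLip φ) (c : ℝ) : BddLip (fun x => c * φ x) :=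
  (BddLip.const c).mul h

theorem BddLip.sub {φ ψ : F → ℝ} (h : BddLip φ) (h' : BddLip ψ) :
    BddLip (fun x => φ x - ψ x) := by
  simpa [sub_eq_add_neg] using h.add (h'.const_mul (-1))

theorem BddLip.abs {φ : F → ℝ} (h : BddLip φ) : BddLip (fun x => |φ x|) := by
  obtain ⟨⟨M, hM⟩, L, hL⟩ := h
  exact ⟨⟨M, fun x => by simpa using hM x⟩, L,
    fun x y => (abs_abs_sub_abs_le_abs_sub _ _).trans (hL x y)⟩

theorem BddLip.pow {φ : F → ℝ} (h : BddLip φ) (n : ℕ) : BddLip (fun x => φ x ^ n) := by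
  induction n with
  | zero => simpa using BddLip.const 1
  | succ n ih => simpa [pow_succ] using ih.mul h

theorem BddLip.exp {φ : F → ℝ} {K : NNReal} (hL : LipschitzWith K φ) {M : ℝ}
    (hM : ∀ x, φ x ≤ M) : BddLip (fun x => Real.exp (φ x)) := by
  refine ⟨⟨Real.exp M, fun x => ?_⟩, Real.exp M * K, fun x y => ?_⟩
  · rw [abs_of_pos (Real.exp_pos _)]
    exact Real.exp_le_exp.2 (hM x)
  · have key : ∀ u v : ℝ, u ≤ v → v ≤ M →
        |Real.exp v - Real.exp u| ≤ Real.exp M * |v - u| := by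
      intro u v huv hv
      rw [abs_of_nonneg (sub_nonneg.2 (Real.exp_le_exp.2 huv)), abs_of_nonneg (sub_nonneg.2 huv)]
      have h1 : Real.exp u = Real.exp v * Real.exp (u - v) := by
        rw [← Real.exp_add]; congr 1; ring
      have h2 := Real.add_one_le_exp (u - v)
      have h3 := Real.exp_le_exp.2 hv
      have h4 := Real.exp_pos v
      rw [h1]
      nlinarith
    have hd : |φ x - φ y| ≤ K * ‖x - y‖ := by
      simpa [Real.dist_eq, dist_eq_norm] using hL.dist_le_mul x y
    have h5 : |Real.exp (φ x) - Real.exp (φ y)| ≤ Real.exp M * |φ x - φ y| := by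
      rcases le_total (φ x) (φ y) with h | h
      · rw [abs_sub_comm, abs_sub_comm (φ x)]
        exact key _ _ h (hM y)
      · exact key _ _ h (hM x)
    calc _ ≤ _ := h5
      _ ≤ Real.exp M * (K * ‖x - y‖) := by gcongr
      _ = _ := by ring

theorem lipschitzWith_const_mul {F : Type*} [PseudoMetricSpace F] {f : F → ℝ} {K : NNReal}
    (hf : LipschitzWith K f) (r : ℝ) : LipschitzWith (‖r‖₊ * K) (fun x => r * f x) := by
  refine LipschitzWith.of_dist_le_mul fun x y => ?_
  rw [Real.dist_eq, ← mul_sub, abs_mul, NNReal.coe_mul, mul_assoc, ← Real.dist_eq]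
  exact mul_le_mul_of_nonneg_left (hf.dist_le_mul x y) (abs_nonneg _)

theorem lipschitzWith_trunc (c : ℝ) : LipschitzWith 1 (fun x : ℝ => max (-c) (min x c)) :=
  (LipschitzWith.id.min_const c).const_max (-c)

theorem abs_trunc_le {c : ℝ} (hc : 0 ≤ c) (x : ℝ) : |max (-c) (min x c)| ≤ c :=
  abs_le.2 ⟨le_max_left _ _, max_le (by linarith) (min_le_right _ _)⟩

theorem abs_trunc {c : ℝ} (hc : 0 ≤ c) (x : ℝ) : |max (-c) (min x c)| = min |x| c := by
  rcases le_total 0 x with hx | hx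
  · rw [abs_of_nonneg hx, max_eq_right, abs_of_nonneg (le_min hx hc)]
    exact (neg_nonpos.2 hc).trans (le_min hx hc)
  · rw [min_eq_left (hx.trans hc), abs_of_nonpos hx, abs_of_nonpos (max_le (by linarith) hx),
      ← min_neg_neg, neg_neg, min_comm]

theorem BddLip.trunc (c : ℝ) : BddLip (fun x : ℝ => max (-c) (min x c)) := by
  refine BddLip.of_lipschitzWith (M := |c|) (lipschitzWith_trunc c) fun x => ?_
  rcases le_total 0 c with hc | hc
  · rw [abs_of_nonneg hc]; exact abs_trunc_le hc x
  · rw [max_eq_left ((min_le_right _ _).trans (by linarith)), abs_neg]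

end BddLipCalculus

/-! ### Real-valued expectation on bounded members of `H`, and the one-step law. -/

namespace SubLinSpace

variable {Ω : Type*} [MeasurableSpace Ω]

open Classical in
/-- The real value of `E[f]` for `f ∈ H`; of use when `f` is bounded. -/
noncomputable def ev (S : SubLinSpace Ω) (f : Ω → ℝ) : ℝ :=
  if h : f ∈ S.H then (S.E ⟨f, h⟩).toReal else 0

/-- The bounded members of `H`. -/
def Bdd (S : SubLinSpace Ω) (f : Ω → ℝ) : Prop :=
  f ∈ S.H ∧ ∃ M : ℝ, ∀ ω, |f ω| ≤ M

variable {S : SubLinSpace Ω}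

theorem const_mem (S : SubLinSpace Ω) (c : ℝ) : (fun _ => c) ∈ S.H :=
  S.comp_mem (n := 0) (fun _ => c) (BddLip.const c).locLip (fun i => i.elim0)

theorem Bdd.const (S : SubLinSpace Ω) (c : ℝ) : S.Bdd (fun _ => c) :=
  ⟨S.const_mem c, |c|, fun _ => le_rfl⟩

/-- A bounded function lies between two constants, so its expectation is finite and `toReal` loses
nothing. -/
theorem Bdd.coe_ev {f : Ω → ℝ} (hf : S.Bdd f) : ((S.ev f : ℝ) : EReal) = S.E ⟨f, hf.1⟩ := by
  obtain ⟨h, M, hM⟩ := hf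
  have h1 : S.E ⟨f, h⟩ ≤ (M : EReal) := by
    rw [← S.const ⟨_, S.const_mem M⟩ M fun _ => rfl]
    exact S.mono _ _ fun ω => (abs_le.1 (hM ω)).2
  have h2 : ((-M : ℝ) : EReal) ≤ S.E ⟨f, h⟩ := by
    rw [← S.const ⟨_, S.const_mem (-M)⟩ (-M) fun _ => rfl]
    exact S.mono _ _ fun ω => (abs_le.1 (hM ω)).1
  rw [ev, dif_pos h, EReal.coe_toReal]
  · exact (h1.trans_lt (EReal.coe_lt_top _)).ne
  · exact ((EReal.bot_lt_coe _).trans_le h2).ne'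

theorem ev_const (S : SubLinSpace Ω) (c : ℝ) : S.ev (fun _ => c) = c := by
  rw [← EReal.coe_eq_coe_iff, (Bdd.const S c).coe_ev]
  exact S.const _ c fun _ => rfl

theorem ev_mono {f g : Ω → ℝ} (hf : S.Bdd f) (hg : S.Bdd g) (h : ∀ ω, f ω ≤ g ω) :
    S.ev f ≤ S.ev g := by
  rw [← EReal.coe_le_coe_iff, hf.coe_ev, hg.coe_ev]
  exact S.mono _ _ h

theorem Bdd.add {f g : Ω → ℝ} (hf : S.Bdd f) (hg : S.Bdd g) : S.Bdd (fun ω => f ω + g ω) := by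
  obtain ⟨h, M, hM⟩ := hf
  obtain ⟨h', M', hM'⟩ := hg
  exact ⟨S.H.add_mem h h', M + M', fun ω => (abs_add_le _ _).trans (add_le_add (hM ω) (hM' ω))⟩

theorem ev_add_le {f g : Ω → ℝ} (hf : S.Bdd f) (hg : S.Bdd g) :
    S.ev (fun ω => f ω + g ω) ≤ S.ev f + S.ev g := by
  rw [← EReal.coe_le_coe_iff, EReal.coe_add, (hf.add hg).coe_ev, hf.coe_ev, hg.coe_ev]
  refine S.subadd ⟨f, hf.1⟩ ⟨g, hg.1⟩ ?_ ?_
  · rw [← hf.coe_ev]; exact fun h => EReal.coe_ne_top _ h.1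
  · rw [← hf.coe_ev]; exact fun h => EReal.coe_ne_bot _ h.1

theorem Bdd.const_mul {f : Ω → ℝ} (hf : S.Bdd f) (c : ℝ) : S.Bdd (fun ω => c * f ω) := by
  obtain ⟨h, M, hM⟩ := hf
  refine ⟨S.H.smul_mem c h, |c| * M, fun ω => ?_⟩
  rw [abs_mul]
  exact mul_le_mul_of_nonneg_left (hM ω) (abs_nonneg _)

theorem ev_const_mul {f : Ω → ℝ} (hf : S.Bdd f) {c : ℝ} (hc : 0 ≤ c) :
    S.ev (fun ω => c * f ω) = c * S.ev f := by
  rw [← EReal.coe_eq_coe_iff, EReal.coe_mul, (hf.const_mul c).coe_ev, hf.coe_ev]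
  exact S.homog ⟨f, hf.1⟩ c hc

theorem ev_nonneg {f : Ω → ℝ} (hf : S.Bdd f) (h : ∀ ω, 0 ≤ f ω) : 0 ≤ S.ev f := by
  rw [← S.ev_const 0]
  exact ev_mono (Bdd.const S 0) hf h

theorem ev_le_const {f : Ω → ℝ} (hf : S.Bdd f) {c : ℝ} (h : ∀ ω, f ω ≤ c) : S.ev f ≤ c := by
  conv_rhs => rw [← S.ev_const c]
  exact ev_mono hf (Bdd.const S c) h

theorem ev_const_add_le {f : Ω → ℝ} (hf : S.Bdd f) (c : ℝ) :
    S.ev (fun ω => c + f ω) ≤ c + S.ev f := by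
  have := ev_add_le (Bdd.const S c) hf
  rwa [S.ev_const] at this

theorem Bdd.sum {ι : Type*} (s : Finset ι) {f : ι → Ω → ℝ} (hf : ∀ i, S.Bdd (f i)) :
    S.Bdd (fun ω => ∑ i ∈ s, f i ω) := by
  classical
  induction s using Finset.induction_on with
  | empty => simpa using Bdd.const S 0
  | insert i s hi ih => simpa [Finset.sum_insert hi] using (hf i).add ih

theorem ev_sum_le {ι : Type*} (s : Finset ι) {f : ι → Ω → ℝ} (hf : ∀ i, S.Bdd (f i)) :
    S.ev (fun ω => ∑ i ∈ s, f i ω) ≤ ∑ i ∈ s, S.ev (f i) := by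
  classical
  induction s using Finset.induction_on with
  | empty => simp [S.ev_const]
  | insert i s hi ih =>
    simp only [Finset.sum_insert hi]
    exact (ev_add_le (hf i) (Bdd.sum s hf)).trans (by gcongr)

theorem Bdd.comp {n : ℕ} {φ : (Fin n → ℝ) → ℝ} (hφ : BddLip φ) {X : Fin n → Ω → ℝ}
    (hX : ∀ i, X i ∈ S.H) : S.Bdd (fun ω => φ (fun i => X i ω)) :=
  ⟨S.comp_mem φ hφ.locLip (fun i => ⟨X i, hX i⟩), hφ.1.imp fun _ h _ => h _⟩

theorem Bdd.comp₁ {φ : ℝ → ℝ} (hφ : BddLip φ) {X : Ω → ℝ} (hX : X ∈ S.H) :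
    S.Bdd (fun ω => φ (X ω)) :=
  ⟨S.comp₁_mem φ hφ.locLip ⟨X, hX⟩, hφ.1.imp fun _ h _ => h _⟩

theorem ev_le_add_of_abs_sub_le {f g d : Ω → ℝ} (hf : S.Bdd f) (hg : S.Bdd g) (hd : S.Bdd d)
    (h : ∀ ω, |f ω - g ω| ≤ d ω) : S.ev f ≤ S.ev g + S.ev d :=
  (ev_mono hf (hg.add hd) fun ω => by linarith [le_abs_self (f ω - g ω), h ω]).trans
    (ev_add_le hg hd)

/-- The consequence of independence that drives the maximal inequality: conditionally on the past
the expectation over the next variable may be bounded first. -/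
def StepLaw (S : SubLinSpace Ω) (Z : ℕ → Ω → ℝ) : Prop :=
  ∀ (k : ℕ) (f : (Fin k → ℝ) → ℝ → ℝ) (G : (Fin k → ℝ) → ℝ),
    BddLip (fun p : (Fin k → ℝ) × ℝ => f p.1 p.2) → BddLip G →
    (∀ x, S.ev (fun ω => f x (Z k ω)) ≤ G x) →
    S.ev (fun ω => f (fun j => Z j ω) (Z k ω)) ≤ S.ev (fun ω => G (fun j => Z j ω))

theorem lipschitzWith_pair_left {F G : Type*} [SeminormedAddCommGroup F]
    [SeminormedAddCommGroup G] (x : F) : LipschitzWith 1 (fun y : G => (x, y)) :=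
  LipschitzWith.of_dist_le_mul fun y z => by simp [Prod.dist_eq]

/-- Integrating out the last variable preserves the class; hence the functions of the past that
occur in `IndepTo` do belong to `H`. -/
theorem bddLip_ev_left {k : ℕ} {f : (Fin k → ℝ) → ℝ → ℝ}
    (hf : BddLip (fun p : (Fin k → ℝ) × ℝ => f p.1 p.2)) {X : Ω → ℝ} (hX : X ∈ S.H) :
    BddLip (fun x => S.ev (fun ω => f x (X ω))) := by
  have hB : ∀ x, S.Bdd (fun ω => f x (X ω)) := fun x =>
    Bdd.comp₁ (hf.comp (lipschitzWith_pair_left x)) hX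
  obtain ⟨⟨M, hM⟩, L, hL⟩ := hf
  have key : ∀ x y, S.ev (fun ω => f x (X ω)) - S.ev (fun ω => f y (X ω)) ≤ L * ‖x - y‖ := by
    intro x y
    have h1 := ev_le_add_of_abs_sub_le (hB x) (hB y) (Bdd.const S (L * ‖x - y‖)) fun ω => by
      simpa [Prod.norm_def] using hL (x, X ω) (y, X ω)
    rw [S.ev_const] at h1
    linarith
  refine ⟨⟨M, fun x => abs_le.2 ⟨?_, ?_⟩⟩, L, fun x y => abs_le.2 ⟨?_, key x y⟩⟩
  · rw [← S.ev_const (-M)]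
    exact ev_mono (Bdd.const S _) (hB x) fun ω => (abs_le.1 (hM (x, X ω))).1
  · exact ev_le_const (hB x) fun ω => (abs_le.1 (hM (x, X ω))).2
  · have := key y x
    rw [norm_sub_rev] at this
    linarith

theorem IndepSeq.stepLaw {Y : ℕ → S.H} (h : S.IndepSeq Y) :
    S.StepLaw (fun i => (Y i : Ω → ℝ)) := by
  intro k f G hf hG hle
  -- `IndepSeq` says nothing about an empty past; there the right side is a constant and the claim
  -- is the hypothesis itself.
  rcases k with _ | k
  · have e : ∀ ω, (fun j : Fin 0 => (Y j : Ω → ℝ) ω) = default := fun ω => Subsingleton.elim _ _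
    simp only [e, S.ev_const]
    exact hle _
  set X : Fin (k + 1) → S.H := fun j => Y j with hX
  set φ : (Fin (k + 1 + 1) → ℝ) → ℝ :=
    fun z => f (fun j => z (Fin.castAdd 1 j)) (z (Fin.natAdd (k + 1) 0)) with hφdef
  have hproj : LipschitzWith 1 (fun z : Fin (k + 1 + 1) → ℝ =>
      ((fun j => z (Fin.castAdd 1 j), z (Fin.natAdd (k + 1) 0)) : (Fin (k + 1) → ℝ) × ℝ)) := by
    refine LipschitzWith.of_dist_le_mul fun y z => ?_
    rw [NNReal.coe_one, one_mul, Prod.dist_eq]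
    exact max_le ((dist_pi_le_iff dist_nonneg).2 fun j => dist_le_pi_dist y z _)
      (dist_le_pi_dist y z _)
  have hφ : BddLip φ := hf.comp hproj
  have hYm := (Y (k + 1)).2
  have hB : ∀ x, S.Bdd (fun ω => f x ((Y (k + 1) : Ω → ℝ) ω)) := fun x =>
    Bdd.comp₁ (hf.comp (lipschitzWith_pair_left x)) hYm
  have hBa : ∀ x, S.Bdd (fun ω => |f x ((Y (k + 1) : Ω → ℝ) ω)|) := fun x =>
    Bdd.comp₁ (hf.abs.comp (lipschitzWith_pair_left x)) hYm
  have e1 : ∀ x, S.E (S.comp (fun y => |φ (Fin.append x y)|)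
      (hφ.locLip.append_left x).abs (fun _ : Fin 1 => Y (k + 1))) =
      ((S.ev (fun ω => |f x ((Y (k + 1) : Ω → ℝ) ω)|) : ℝ) : EReal) := by
    intro x
    rw [(hBa x).coe_ev]
    congr 1
    ext ω
    simp [SubLinSpace.comp, hφdef, Fin.append_left, Fin.append_right]
  have e2 : ∀ x, S.E (S.comp (fun y => φ (Fin.append x y))
      (hφ.locLip.append_left x) (fun _ : Fin 1 => Y (k + 1))) =
      ((S.ev (fun ω => f x ((Y (k + 1) : Ω → ℝ) ω)) : ℝ) : EReal) := by
    intro x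
    rw [(hB x).coe_ev]
    congr 1
    ext ω
    simp [SubLinSpace.comp, hφdef, Fin.append_left, Fin.append_right]
  have hXm : ∀ i, (X i : Ω → ℝ) ∈ S.H := fun i => (X i).2
  have b1 : S.Bdd (fun ω => S.ev (fun ω' => |f (fun i => (X i : Ω → ℝ) ω)
      ((Y (k + 1) : Ω → ℝ) ω')|)) :=
    Bdd.comp (bddLip_ev_left (f := fun x y => |f x y|) hf.abs hYm) hXm
  have b2 : S.Bdd (fun ω => S.ev (fun ω' => f (fun i => (X i : Ω → ℝ) ω)
      ((Y (k + 1) : Ω → ℝ) ω'))) := Bdd.comp (bddLip_ev_left hf hYm) hXm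
  have key := h k φ hφ.locLip (fun x => by rw [e1]; exact EReal.coe_lt_top _)
  have hbar : (fun ω => (S.E (S.comp
          (fun y => |φ (Fin.append (fun i => (X i : Ω → ℝ) ω) y)|)
          (hφ.locLip.append_left (fun i => (X i : Ω → ℝ) ω)).abs
          (fun _ : Fin 1 => Y (k + 1)))).toReal) ∈ S.H := by
    simp only [e1, EReal.toReal_coe]; exact b1.1
  have hin : (fun ω => (S.E (S.comp
          (fun y => φ (Fin.append (fun i => (X i : Ω → ℝ) ω) y))
          (hφ.locLip.append_left (fun i => (X i : Ω → ℝ) ω))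
          (fun _ : Fin 1 => Y (k + 1)))).toReal) ∈ S.H := by
    simp only [e2, EReal.toReal_coe]; exact b2.1
  have hfin : S.E ⟨_, hbar⟩ < ⊤ := by
    have : S.E ⟨_, hbar⟩ = S.E ⟨_, b1.1⟩ := by
      congr 2
      funext ω
      rw [e1, EReal.toReal_coe]
    rw [this, ← b1.coe_ev]
    exact EReal.coe_lt_top _
  have key2 := key hbar hin hfin
  have hBt : S.Bdd (fun ω => f (fun j => (X j : Ω → ℝ) ω) ((Y (k + 1) : Ω → ℝ) ω)) := by
    have := Bdd.comp (S := S) hφ (X := fun i => (Y i : Ω → ℝ)) fun i => (Y i).2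
    simpa [hφdef] using this
  have e3 : S.E (S.comp φ hφ.locLip (Fin.append X (fun _ : Fin 1 => Y (k + 1)))) =
      ((S.ev (fun ω => f (fun j => (X j : Ω → ℝ) ω) ((Y (k + 1) : Ω → ℝ) ω)) : ℝ) : EReal) := by
    rw [hBt.coe_ev]
    congr 1
    ext ω
    simp [SubLinSpace.comp, hφdef, Fin.append_left, Fin.append_right]
  have e4 : S.E ⟨_, hin⟩ = S.E ⟨_, b2.1⟩ := by
    congr 2
    funext ω
    rw [e2, EReal.toReal_coe]
  rw [e3, e4, ← b2.coe_ev, EReal.coe_eq_coe_iff] at key2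
  rw [key2]
  exact ev_mono b2 (Bdd.comp hG hXm) fun ω => hle _

/-- Needed for the centred variables `Y - a` and for `-Y`. -/
theorem StepLaw.comp {Y : ℕ → Ω → ℝ} (h : S.StepLaw Y) {A : ℝ → ℝ} {K : NNReal}
    (hA : LipschitzWith K A) : S.StepLaw (fun i ω => A (Y i ω)) := by
  intro k f G hf hG hle
  have hA' : LipschitzWith K (fun x : Fin k → ℝ => fun j => A (x j)) := by
    refine LipschitzWith.of_dist_le_mul fun y z => ?_
    refine (dist_pi_le_iff (by positivity)).2 fun j => ?_
    refine (hA.dist_le_mul _ _).trans ?_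
    gcongr
    exact dist_le_pi_dist y z j
  refine h k (fun x y => f (fun j => A (x j)) (A y)) (fun x => G (fun j => A (x j))) ?_
    (hG.comp hA') (fun x => hle _)
  exact hf.comp ((hA'.comp LipschitzWith.prod_fst).prodMk (hA.comp LipschitzWith.prod_snd))

end SubLinSpace

/-! ### Exponential maximal inequality. -/

section MaximalInequality

/-- The partial sum `∑_{i < j} t (z i)`. -/
def psum (t : ℝ → ℝ) (j : ℕ) (z : ℕ → ℝ) : ℝ := ∑ i ∈ Finset.range j, t (z i)

/-- The maximum of the partial sums up to time `j`. -/
noncomputable def pmax (t : ℝ → ℝ) : ℕ → (ℕ → ℝ) → ℝ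
  | 0, _ => 0
  | j + 1, z => max (pmax t j z) (psum t (j + 1) z)

/-- Extension of a vector by zero to a sequence. -/
def extZero {k : ℕ} (x : Fin k → ℝ) (i : ℕ) : ℝ := if h : i < k then x ⟨i, h⟩ else 0

theorem psum_congr {t : ℝ → ℝ} {j : ℕ} {z z' : ℕ → ℝ} (h : ∀ i < j, z i = z' i) :
    psum t j z = psum t j z' :=
  Finset.sum_congr rfl fun i hi => by rw [h i (Finset.mem_range.1 hi)]

theorem pmax_congr {t : ℝ → ℝ} {j : ℕ} {z z' : ℕ → ℝ} (h : ∀ i < j, z i = z' i) :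
    pmax t j z = pmax t j z' := by
  induction j with
  | zero => rfl
  | succ j ih => rw [pmax, pmax, ih fun i hi => h i (by omega), psum_congr h]

theorem psum_le_pmax (t : ℝ → ℝ) {j n : ℕ} (h : j ≤ n) (z : ℕ → ℝ) :
    psum t j z ≤ pmax t n z := by
  induction n with
  | zero => simp [Nat.le_zero.1 h, psum, pmax]
  | succ n ih =>
    rcases h.lt_or_eq with h | rfl
    · exact (ih (by omega)).trans (le_max_left _ _)
    · exact le_max_right _ _

theorem extZero_apply {k : ℕ} (z : ℕ → ℝ) {i : ℕ} (h : i < k) :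
    extZero (fun j : Fin k => z j) i = z i := by simp [extZero, h]

theorem lipschitzWith_extZero {k : ℕ} (i : ℕ) :
    LipschitzWith 1 (fun x : Fin k → ℝ => extZero x i) := by
  by_cases h : i < k
  · simpa [extZero, h] using LipschitzWith.eval (α := fun _ : Fin k => ℝ) ⟨i, h⟩
  · simpa [extZero, h] using (LipschitzWith.const (0 : ℝ)).weaken (zero_le_one)

variable {t : ℝ → ℝ} {Kt : NNReal}

theorem exists_lipschitzWith_psum (ht : LipschitzWith Kt t) (k j : ℕ) :
    ∃ K, LipschitzWith K (fun x : Fin k → ℝ => psum t j (extZero x)) := by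
  induction j with
  | zero => exact ⟨0, by simp [psum]⟩
  | succ j ih =>
    obtain ⟨K, hK⟩ := ih
    refine ⟨K + Kt * 1, ?_⟩
    simp only [psum, Finset.sum_range_succ]
    exact hK.add (ht.comp (lipschitzWith_extZero j))

theorem exists_lipschitzWith_pmax (ht : LipschitzWith Kt t) (k j : ℕ) :
    ∃ K, LipschitzWith K (fun x : Fin k → ℝ => pmax t j (extZero x)) := by
  induction j with
  | zero => exact ⟨0, by simp [pmax]⟩
  | succ j ih =>
    obtain ⟨K, hK⟩ := ih
    obtain ⟨K', hK'⟩ := exists_lipschitzWith_psum ht k (j + 1)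
    exact ⟨_, hK.max hK'⟩

theorem BddLip.exp_min_zero {F : Type*} [SeminormedAddCommGroup F] {φ : F → ℝ} {K : NNReal}
    (hφ : LipschitzWith K φ) (h c : ℝ) : BddLip (fun p => Real.exp (min 0 (h * φ p + c))) := by
  exact BddLip.exp (((lipschitzWith_const_mul hφ h).add (LipschitzWith.const c)).const_min 0) (M := 0)
    fun _ => min_le_left _ _

namespace SubLinSpace

variable {Ω : Type*} [MeasurableSpace Ω] {S : SubLinSpace Ω} {Z : ℕ → Ω → ℝ}

/-- The potential along which the maximal inequality is propagated. -/
noncomputable def maxPot (t ψ : ℝ → ℝ) (h x c : ℝ) (j : ℕ) (z : ℕ → ℝ) : ℝ :=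
  ψ (pmax t j z) + (1 - ψ (pmax t j z)) * Real.exp (min 0 (h * psum t j z + (c - h * x)))

theorem bddLip_maxPot {ψ : ℝ → ℝ} (ht : LipschitzWith Kt t) (hψ : BddLip ψ) (h x c : ℝ)
    (k j : ℕ) : BddLip (fun z : Fin k → ℝ => maxPot t ψ h x c j (extZero z)) := by
  obtain ⟨K, hK⟩ := exists_lipschitzWith_psum ht k j
  obtain ⟨K', hK'⟩ := exists_lipschitzWith_pmax ht k j
  exact (hψ.comp hK').add (((BddLip.const 1).sub (hψ.comp hK')).mul (BddLip.exp_min_zero hK h _))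

/-- The cap at exponent 0 keeps the exponential bounded and does not spoil the one-step bound: if
the new exponent is nonnegative the bound is 1, and otherwise the cap may be dropped and the past
factored out. -/
theorem ev_exp_min_zero_le (hZ : ∀ i, Z i ∈ S.H)
    (hid : ∀ (φ : ℝ → ℝ), BddLip φ → ∀ i, S.ev (fun ω => φ (Z i ω)) = S.ev (fun ω => φ (Z 0 ω)))
    (ht : LipschitzWith Kt t) {M : ℝ} (htM : ∀ y, |t y| ≤ M) {h lam : ℝ} (hh : 0 ≤ h)
    (hlam : S.ev (fun ω => Real.exp (h * t (Z 0 ω))) ≤ Real.exp lam) (s c : ℝ) (k : ℕ) :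
    S.ev (fun ω => Real.exp (min 0 (h * (s + t (Z k ω)) + c)))
      ≤ Real.exp (min 0 (h * s + (c + lam))) := by
  have hst : LipschitzWith (0 + Kt) (fun y => s + t y) := (LipschitzWith.const s).add ht
  have hb1 : BddLip (fun y => Real.exp (min 0 (h * (s + t y) + c))) := BddLip.exp_min_zero hst h c
  have hb2 : BddLip (fun y => Real.exp (h * t y)) :=
    BddLip.exp (lipschitzWith_const_mul ht h) (M := h * M)
      fun y => mul_le_mul_of_nonneg_left (abs_le.1 (htM y)).2 hh
  rcases le_total 0 (h * s + (c + lam)) with h0 | h0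
  · rw [min_eq_left h0, Real.exp_zero]
    exact ev_le_const (Bdd.comp₁ hb1 (hZ k)) fun ω =>
      Real.exp_le_one_iff.2 (min_le_left _ _)
  · rw [min_eq_right h0]
    calc _ ≤ S.ev (fun ω => Real.exp (h * s + c) * Real.exp (h * t (Z k ω))) := by
          refine ev_mono (Bdd.comp₁ hb1 (hZ k)) ((Bdd.comp₁ hb2 (hZ k)).const_mul _) fun ω => ?_
          rw [← Real.exp_add]
          refine Real.exp_le_exp.2 ((min_le_right _ _).trans (le_of_eq ?_))
          ring
      _ = Real.exp (h * s + c) * S.ev (fun ω => Real.exp (h * t (Z 0 ω))) := by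
          rw [ev_const_mul (Bdd.comp₁ hb2 (hZ k)) (Real.exp_nonneg _), hid _ hb2 k]
      _ ≤ Real.exp (h * s + c) * Real.exp lam := by gcongr
      _ = _ := by rw [← Real.exp_add]; congr 1; ring

/-- Updating the maximum inside `ψ` costs nothing. If the new sum is a record below `x`, then `ψ`
vanishes before and after; if it is a record above `x`, the capped exponential equals 1 (here `0 ≤
c` enters) and both sides are 1. -/
theorem maxPot_succ_le {ψ : ℝ → ℝ} {h x c : ℝ} (hh : 0 ≤ h) (hc : 0 ≤ c)
    (hψx : ∀ u ≤ x, ψ u = 0) (j : ℕ) (z : ℕ → ℝ) :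
    maxPot t ψ h x c (j + 1) z ≤ ψ (pmax t j z) + (1 - ψ (pmax t j z)) *
      Real.exp (min 0 (h * (psum t j z + t (z j)) + (c - h * x))) := by
  have e : psum t j z + t (z j) = psum t (j + 1) z := (Finset.sum_range_succ _ _).symm
  rw [e, maxPot, pmax]
  rcases le_total (psum t (j + 1) z) (pmax t j z) with hle | hle
  · rw [max_eq_left hle]
  · rw [max_eq_right hle]
    rcases le_total (psum t (j + 1) z) x with hx | hx
    · rw [hψx _ hx, hψx _ (hle.trans hx)]
    · have h0 : 0 ≤ h * psum t (j + 1) z + (c - h * x) := by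
        nlinarith [mul_le_mul_of_nonneg_left hx hh]
      rw [min_eq_left h0, Real.exp_zero]
      linarith

/-- The exponential maximal inequality. -/
theorem StepLaw.ev_pmax_le (hstep : S.StepLaw Z) (hZ : ∀ i, Z i ∈ S.H)
    (hid : ∀ (φ : ℝ → ℝ), BddLip φ → ∀ i, S.ev (fun ω => φ (Z i ω)) = S.ev (fun ω => φ (Z 0 ω)))
    (ht : LipschitzWith Kt t) {M : ℝ} (htM : ∀ y, |t y| ≤ M) {h lam : ℝ} (hh : 0 ≤ h)
    (hlam0 : 0 ≤ lam) (hlam : S.ev (fun ω => Real.exp (h * t (Z 0 ω))) ≤ Real.exp lam)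
    {ψ : ℝ → ℝ} (hψ : BddLip ψ) (hψ1 : ∀ u, ψ u ≤ 1) {x : ℝ} (hx : 0 ≤ x)
    (hψx : ∀ u ≤ x, ψ u = 0) (n : ℕ) :
    S.Bdd (fun ω => ψ (pmax t n (fun i => Z i ω))) ∧
    S.ev (fun ω => ψ (pmax t n (fun i => Z i ω))) ≤ Real.exp (-(h * x) + n * lam) := by
  -- The constant `(n - j) * lam` reserves one factor `exp lam` for each remaining step. So the
  -- expected potential does not increase in `j`: it starts at or below the claimed bound, and at `j
  -- = n` it dominates `ψ` of the maximum.
  set W : ℕ → (ℕ → ℝ) → ℝ := fun j => maxPot t ψ h x ((n - j : ℝ) * lam) j with hW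
  have hWext : ∀ c j ω, maxPot t ψ h x c j (extZero (fun i : Fin j => Z i ω)) =
      maxPot t ψ h x c j (fun i => Z i ω) := by
    intro c j ω
    have h1 : ∀ i < j, extZero (fun i : Fin j => Z i ω) i = Z i ω := fun i hi =>
      extZero_apply (fun i => Z i ω) hi
    rw [maxPot, maxPot, pmax_congr h1, psum_congr h1]
  have hWB : ∀ c j, S.Bdd (fun ω => maxPot t ψ h x c j (fun i => Z i ω)) := by
    intro c j
    have := Bdd.comp (S := S) (bddLip_maxPot ht hψ h x c j j) (X := fun i => Z i) fun i => hZ i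
    simpa only [hWext] using this
  have hmain : ∀ j ≤ n, S.ev (fun ω => W j (fun i => Z i ω)) ≤ Real.exp (-(h * x) + n * lam) := by
    intro j
    induction j with
    | zero =>
      intro _
      refine ev_le_const (hWB _ _) fun ω => ?_
      simp only [maxPot, pmax, psum, hψx 0 hx]
      simp only [Finset.range_zero, Finset.sum_empty, sub_zero, one_mul, zero_add]
      refine Real.exp_le_exp.2 ((min_le_right _ _).trans (le_of_eq ?_))
      push_cast; ring
    | succ k ih =>
      intro hk
      refine le_trans ?_ (ih (by omega))
      set c : ℝ := (n - (k + 1 : ℕ) : ℝ) * lam with hcdef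
      have hkn : ((k + 1 : ℕ) : ℝ) ≤ n := by exact_mod_cast hk
      have hc : 0 ≤ c := mul_nonneg (by linarith) hlam0
      have hcs : c - h * x + lam = (n - k : ℝ) * lam - h * x := by
        rw [hcdef]; push_cast; ring
      obtain ⟨K, hK⟩ := exists_lipschitzWith_psum ht k k
      obtain ⟨K', hK'⟩ := exists_lipschitzWith_pmax ht k k
      set f : (Fin k → ℝ) → ℝ → ℝ := fun p y => ψ (pmax t k (extZero p)) +
        (1 - ψ (pmax t k (extZero p))) *
          Real.exp (min 0 (h * (psum t k (extZero p) + t y) + (c - h * x))) with hf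
      have hfB : BddLip (fun p : (Fin k → ℝ) × ℝ => f p.1 p.2) := by
        have h1 : BddLip (fun p : (Fin k → ℝ) × ℝ => ψ (pmax t k (extZero p.1))) :=
          (hψ.comp hK').comp LipschitzWith.prod_fst
        have h2 : LipschitzWith (K * 1 + Kt * 1)
            (fun p : (Fin k → ℝ) × ℝ => psum t k (extZero p.1) + t p.2) :=
          (hK.comp LipschitzWith.prod_fst).add (ht.comp LipschitzWith.prod_snd)
        exact h1.add (((BddLip.const 1).sub h1).mul (BddLip.exp_min_zero h2 h _))
      have hle : ∀ p, S.ev (fun ω => f p (Z k ω)) ≤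
          maxPot t ψ h x ((n - k : ℝ) * lam) k (extZero p) := by
        intro p
        have hqB : S.Bdd (fun ω =>
            Real.exp (min 0 (h * (psum t k (extZero p) + t (Z k ω)) + (c - h * x)))) :=
          Bdd.comp₁ (BddLip.exp_min_zero ((LipschitzWith.const (psum t k (extZero p))).add ht)
            h _) (hZ k)
        have h1ψ : 0 ≤ 1 - ψ (pmax t k (extZero p)) := sub_nonneg.2 (hψ1 _)
        refine (ev_const_add_le (hqB.const_mul _) _).trans ?_
        rw [ev_const_mul hqB h1ψ, maxPot, ← hcs]
        gcongr
        exact ev_exp_min_zero_le hZ hid ht htM hh hlam _ _ k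
      have hst := hstep k f _ hfB (bddLip_maxPot ht hψ h x _ k k) hle
      simp only [hWext] at hst
      have hfext : ∀ ω, f (fun j => Z j ω) (Z k ω) = ψ (pmax t k (fun i => Z i ω)) +
          (1 - ψ (pmax t k (fun i => Z i ω))) * Real.exp (min 0 (h *
            (psum t k (fun i => Z i ω) + t (Z k ω)) + (c - h * x))) := by
        intro ω
        have h1 : ∀ i < k, extZero (fun i : Fin k => Z i ω) i = Z i ω := fun i hi =>
          extZero_apply (fun i => Z i ω) hi
        simp only [hf, pmax_congr h1, psum_congr h1]
      refine le_trans (ev_mono (hWB _ _) ?_ fun ω => ?_) hst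
      · have h1 := Bdd.comp (S := S) (n := k + 1)
          (φ := fun q => f (fun j => q j.castSucc) (q (Fin.last k))) (X := fun i => Z i)
          ?_ fun i => hZ i
        · simpa using h1
        · refine hfB.comp (K := 1) (f := fun q : Fin (k + 1) → ℝ =>
            ((fun j : Fin k => q j.castSucc, q (Fin.last k)) : (Fin k → ℝ) × ℝ)) ?_
          refine LipschitzWith.of_dist_le_mul fun y z => ?_
          rw [NNReal.coe_one, one_mul, Prod.dist_eq]
          exact max_le ((dist_pi_le_iff dist_nonneg).2 fun j => dist_le_pi_dist y z _)
            (dist_le_pi_dist y z _)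
      · rw [hfext]
        exact maxPot_succ_le hh hc hψx k _
  have hB : S.Bdd (fun ω => ψ (pmax t n (fun i => Z i ω))) := by
    obtain ⟨K', hK'⟩ := exists_lipschitzWith_pmax ht n n
    have := Bdd.comp (S := S) (hψ.comp hK') (X := fun i => Z i) fun i => hZ i
    have h1 : ∀ ω, pmax t n (extZero (fun i : Fin n => Z i ω)) = pmax t n (fun i => Z i ω) :=
      fun ω => pmax_congr fun i hi => extZero_apply (fun i => Z i ω) hi
    simpa only [h1] using this
  refine ⟨hB, le_trans (ev_mono hB (hWB _ _) fun ω => ?_) (hmain n le_rfl)⟩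
  exact le_add_of_nonneg_right (mul_nonneg (sub_nonneg.2 (hψ1 _)) (Real.exp_nonneg _))

end SubLinSpace

/-- The exact coefficient 1/2 of the square is what makes the final constant sharp; only the cubic
remainder is estimated crudely. -/
theorem Real.exp_le_taylor_two_add {u H : ℝ} (h : |u| ≤ H) :
    Real.exp u ≤ 1 + u + u ^ 2 / 2 + |u| ^ 3 * Real.exp H := by
  have h1 := Complex.norm_exp_sub_sum_le_norm_mul_exp (u : ℂ) 3
  have h2 : Complex.exp (u : ℂ) - ∑ m ∈ Finset.range 3, (u : ℂ) ^ m / (m.factorial : ℂ) =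
      ((Real.exp u - (1 + u + u ^ 2 / 2) : ℝ) : ℂ) := by
    simp [Finset.sum_range_succ, Nat.factorial]
  rw [h2, Complex.norm_real, Complex.norm_real, Real.norm_eq_abs, Real.norm_eq_abs] at h1
  have h3 := le_abs_self (Real.exp u - (1 + u + u ^ 2 / 2))
  have h4 : |u| ^ 3 * Real.exp |u| ≤ |u| ^ 3 * Real.exp H := by gcongr
  linarith

namespace SubLinSpace

variable {Ω : Type*} [MeasurableSpace Ω] {S : SubLinSpace Ω}

/-- Take expectations in the third-order expansion. All coefficients are nonnegative, so
sub-additivity and positive homogeneity suffice, and only an upper bound on the mean is required. -/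
theorem ev_exp_le {X : Ω → ℝ} (hX : X ∈ S.H) (ht : BddLip t) {y m B A h : ℝ} (hh : 0 ≤ h)
    (hy : ∀ u, |t u| ≤ y) (hm : S.ev (fun ω => t (X ω)) ≤ m)
    (hB : S.ev (fun ω => t (X ω) ^ 2) ≤ B) (hA : S.ev (fun ω => |t (X ω)| ^ 3) ≤ A) :
    S.ev (fun ω => Real.exp (h * t (X ω))) ≤
      Real.exp (h * m + h ^ 2 * B / 2 + h ^ 3 * Real.exp (h * y) * A) := by
  obtain ⟨K, hK⟩ := ht.exists_lipschitzWith
  have hb : BddLip (fun u => Real.exp (h * t u)) :=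
    BddLip.exp (lipschitzWith_const_mul hK h) (M := h * y)
      fun u => mul_le_mul_of_nonneg_left (abs_le.1 (hy u)).2 hh
  have b1 := (Bdd.comp₁ ht hX)
  have b2 := (Bdd.comp₁ (ht.pow 2) hX)
  have b3 := (Bdd.comp₁ (ht.abs.pow 3) hX)
  have hc2 : 0 ≤ h ^ 2 / 2 := by positivity
  have hc3 : 0 ≤ h ^ 3 * Real.exp (h * y) := by positivity
  calc _ ≤ S.ev (fun ω => 1 + (h * t (X ω) + (h ^ 2 / 2 * t (X ω) ^ 2 +
        h ^ 3 * Real.exp (h * y) * |t (X ω)| ^ 3))) := by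
        refine ev_mono (Bdd.comp₁ hb hX) ((Bdd.const S 1).add ((b1.const_mul _).add
          ((b2.const_mul _).add (b3.const_mul _)))) fun ω => ?_
        have := Real.exp_le_taylor_two_add (u := h * t (X ω)) (H := h * y) (by
          rw [abs_mul, abs_of_nonneg hh]
          exact mul_le_mul_of_nonneg_left (hy _) hh)
        rw [abs_mul, abs_of_nonneg hh] at this
        refine this.trans (le_of_eq ?_)
        ring
    _ ≤ 1 + (h * m + (h ^ 2 / 2 * B + h ^ 3 * Real.exp (h * y) * A)) := by
        refine (ev_const_add_le ((b1.const_mul _).add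
          ((b2.const_mul _).add (b3.const_mul _))) _).trans ?_
        gcongr
        refine (ev_add_le (b1.const_mul _) ((b2.const_mul _).add (b3.const_mul _))).trans ?_
        refine add_le_add ?_ ((ev_add_le (b2.const_mul _) (b3.const_mul _)).trans
          (add_le_add ?_ ?_))
        · rw [ev_const_mul b1 hh]; gcongr
        · rw [ev_const_mul b2 hc2]; gcongr
        · rw [ev_const_mul b3 hc3]; gcongr
    _ ≤ _ := by
        refine le_trans (le_of_eq ?_) (Real.add_one_le_exp _)
        ring

end SubLinSpace

end MaximalInequality

/-- Optimising the exponential bound between its Gaussian and its polynomial range. -/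
theorem le_of_forall_le_exp {P τ D : ℝ} (hP1 : P ≤ 1) (hτ : 0 ≤ τ) (hD : 0 < D)
    (hP : ∀ w, 0 ≤ w → P ≤ Real.exp (-w + w ^ 2 / (2 * D) + τ * w ^ 3 * Real.exp (w / 4))) :
    P ≤ Real.exp 384 * (τ + Real.exp (-(D / 2))) := by
  have hC : 1 ≤ Real.exp 384 := Real.one_le_exp (by norm_num)
  -- 384 = 4³ · 3!, from (w/4)³ / 3! ≤ exp(w/4).
  have hpoly : ∀ w, 0 ≤ w → w ^ 3 * Real.exp (-(w / 4)) ≤ 384 := by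
    intro w hw
    have h1 := Real.pow_div_factorial_le_exp (w / 4) (by positivity) 3
    rw [Real.exp_neg, ← div_eq_mul_inv, div_le_iff₀ (Real.exp_pos _)]
    norm_num [Nat.factorial] at h1
    nlinarith
  have he := Real.exp_pos (-(D / 2))
  rcases le_or_gt 1 τ with h1 | h1
  · nlinarith
  -- Gaussian range: `w = D` minimises `-w + w² / (2D)`, with value `-D/2`, and τ is small enough to
  -- keep the cubic term bounded.
  rcases le_or_gt τ (Real.exp (-(D / 2))) with h2 | h2
  · have h3 : τ * D ^ 3 * Real.exp (D / 4) ≤ 384 := by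
      refine le_trans ?_ (hpoly D hD.le)
      calc τ * D ^ 3 * Real.exp (D / 4)
          ≤ Real.exp (-(D / 2)) * D ^ 3 * Real.exp (D / 4) := by gcongr
        _ = D ^ 3 * (Real.exp (-(D / 2)) * Real.exp (D / 4)) := by ring
        _ = _ := by rw [← Real.exp_add]; congr 2; ring
    have h4 : -D + D ^ 2 / (2 * D) = -(D / 2) := by field_simp; ring
    calc P ≤ _ := hP D hD.le
      _ ≤ Real.exp (-(D / 2) + 384) := by rw [h4]; gcongr
      _ = Real.exp 384 * Real.exp (-(D / 2)) := by rw [Real.exp_add, mul_comm]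
      _ ≤ _ := by gcongr; linarith
  · have hτ0 : 0 < τ := he.trans h2
    -- Polynomial range: this `w` solves `τ = exp(-w/2)`. As `w ≤ D`, the quadratic term is at most
    -- `w/2`, so the bound is a constant times τ.
    set w := -2 * Real.log τ with hw
    have hlog : Real.log τ < 0 := Real.log_neg hτ0 h1
    have hw0 : 0 ≤ w := by linarith
    have hwD : w ≤ D := by
      have := (Real.lt_log_iff_exp_lt hτ0).2 h2
      linarith
    have hτw : τ = Real.exp (-(w / 2)) := by
      rw [hw, show -(-2 * Real.log τ / 2) = Real.log τ by ring, Real.exp_log hτ0]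
    have h3 : τ * w ^ 3 * Real.exp (w / 4) ≤ 384 := by
      refine le_trans (le_of_eq ?_) (hpoly w hw0)
      rw [hτw, show Real.exp (-(w / 2)) * w ^ 3 * Real.exp (w / 4) =
        w ^ 3 * (Real.exp (-(w / 2)) * Real.exp (w / 4)) by ring, ← Real.exp_add]
      congr 2; ring
    have h4 : w ^ 2 / (2 * D) ≤ w / 2 := by
      rw [div_le_div_iff₀ (by positivity) two_pos]
      nlinarith
    calc P ≤ _ := hP w hw0
      _ ≤ Real.exp (-(w / 2) + 384) := by gcongr; linarith
      _ = Real.exp 384 * τ := by rw [Real.exp_add, mul_comm, ← hτw]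
      _ ≤ _ := by gcongr; linarith

/-! ### The iterated logarithm and the dyadic scale. -/

section Scales

theorem plog_mono : Monotone plog := fun _ _ h =>
  Real.log_le_log (lt_max_of_lt_left (Real.exp_pos 1)) (max_le_max le_rfl h)

theorem one_le_plog (x : ℝ) : 1 ≤ plog x := by
  rw [plog, Real.le_log_iff_exp_le (lt_max_of_lt_left (Real.exp_pos 1))]
  exact le_max_left _ _

theorem plog_le_max (x : ℝ) : plog x ≤ max 1 x := by
  have h0 : 0 < max (Real.exp 1) x := lt_max_of_lt_left (Real.exp_pos 1)
  rcases le_total x (Real.exp 1) with h | h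
  · rw [plog, max_eq_left h, Real.log_exp]
    exact le_max_left _ _
  · rw [plog, max_eq_right h]
    exact (Real.log_le_sub_one_of_pos ((Real.exp_pos 1).trans_le h)).trans
      ((by linarith : x - 1 ≤ x).trans (le_max_right _ _))

/-- Crude slow variation, from log c ≤ c - 1 and `1 ≤ plog u`; its multiplicative form lets it be
iterated for `llog`. -/
theorem plog_mul_le {c : ℝ} (hc : 1 ≤ c) (u : ℝ) : plog (c * u) ≤ c * plog u := by
  have h0 : 0 < max (Real.exp 1) u := lt_max_of_lt_left (Real.exp_pos 1)
  have h1 : max (Real.exp 1) (c * u) ≤ c * max (Real.exp 1) u := by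
    refine max_le ?_ (by gcongr; exact le_max_right _ _)
    nlinarith [le_max_left (Real.exp 1) u, Real.exp_pos 1]
  have h2 : plog (c * u) ≤ Real.log c + plog u := by
    rw [plog, plog, ← Real.log_mul (by positivity) h0.ne']
    exact Real.log_le_log (lt_max_of_lt_left (Real.exp_pos 1)) h1
  have h3 := Real.log_le_sub_one_of_pos (zero_lt_one.trans_le hc)
  nlinarith [one_le_plog u]

/-- The iterated logarithm. -/
noncomputable def llog (x : ℝ) : ℝ := plog (plog x)

theorem llog_mono : Monotone llog := plog_mono.comp plog_mono

theorem one_le_llog (x : ℝ) : 1 ≤ llog x := one_le_plog _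

theorem llog_pos (x : ℝ) : 0 < llog x := zero_lt_one.trans_le (one_le_llog x)

theorem llog_mul_le {c : ℝ} (hc : 1 ≤ c) (u : ℝ) : llog (c * u) ≤ c * llog u :=
  (plog_mono (plog_mul_le hc u)).trans (plog_mul_le hc _)

theorem llog_le_max (x : ℝ) : llog x ≤ max 1 x :=
  (plog_le_max _).trans (max_le (le_max_left _ _) (plog_le_max x))

/-- The dyadic scale `√(2ʲ log log 2ʲ)`. -/
noncomputable def scale (j : ℕ) : ℝ := Real.sqrt (2 ^ j * llog (2 ^ j))

theorem sq_scale (j : ℕ) : scale j ^ 2 = 2 ^ j * llog (2 ^ j) :=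
  Real.sq_sqrt (mul_nonneg (by positivity) (llog_pos _).le)

theorem scale_pos (j : ℕ) : 0 < scale j :=
  Real.sqrt_pos.2 (mul_pos (by positivity) (llog_pos _))

theorem scale_le_two_pow (j : ℕ) : scale j ≤ 2 ^ j := by
  refine Real.sqrt_le_iff.2 ⟨by positivity, ?_⟩
  have h : llog (2 ^ j) ≤ 2 ^ j :=
    (llog_le_max _).trans (max_le (one_le_pow₀ one_le_two) le_rfl)
  rw [sq]
  gcongr

/-- With `scale_add_le` this places the growth per dyadic step between √2 and 2. The lower rate
makes cubes outgrow 2ᴶ in the third-moment sum; the upper rate compares a truncation level with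
earlier ones. -/
theorem two_pow_mul_sq_scale_le (j k : ℕ) : 2 ^ k * scale j ^ 2 ≤ scale (j + k) ^ 2 := by
  rw [sq_scale, sq_scale, pow_add, mul_comm (2 ^ j : ℝ) (2 ^ k), mul_assoc]
  have : llog (2 ^ j) ≤ llog (2 ^ k * 2 ^ j) :=
    llog_mono (le_mul_of_one_le_left (by positivity) (one_le_pow₀ one_le_two))
  gcongr

theorem scale_add_le (j k : ℕ) : scale (j + k) ≤ 2 ^ k * scale j := by
  refine Real.sqrt_le_iff.2 ⟨mul_nonneg (by positivity) (scale_pos j).le, ?_⟩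
  rw [mul_pow, sq_scale, pow_add, mul_comm (2 ^ j : ℝ) (2 ^ k), mul_assoc]
  have := llog_mul_le (c := 2 ^ k) (one_le_pow₀ one_le_two) (2 ^ j)
  calc (2 : ℝ) ^ k * (2 ^ j * llog (2 ^ k * 2 ^ j))
      ≤ 2 ^ k * (2 ^ j * (2 ^ k * llog (2 ^ j))) := by gcongr
    _ = _ := by ring

theorem scale_mono : Monotone scale := monotone_nat_of_le_succ fun j => by
  have h := two_pow_mul_sq_scale_le j 1
  have h0 := scale_pos j
  exact abs_le_of_sq_le_sq' (by nlinarith [sq_nonneg (scale j)]) (scale_pos _).le |>.2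

theorem tendsto_scale : Tendsto scale atTop atTop := by
  have h : Tendsto (fun j : ℕ => Real.sqrt ((2 : ℝ) ^ j)) atTop atTop :=
    Real.tendsto_sqrt_atTop.comp (tendsto_pow_atTop_atTop_of_one_lt one_lt_two)
  refine tendsto_atTop_mono (fun j => Real.sqrt_le_sqrt ?_) h
  exact le_mul_of_one_le_right (by positivity) (one_le_llog _)

theorem sqrt_two_pow_mul_scale_le (j k : ℕ) : Real.sqrt 2 ^ k * scale j ≤ scale (j + k) := by
  refine abs_le_of_sq_le_sq (a := Real.sqrt 2 ^ k * scale j) ?_ (scale_pos _).le |> (le_abs_self _).trans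
  rw [mul_pow, ← pow_mul, mul_comm k 2, pow_mul, Real.sq_sqrt zero_le_two]
  exact two_pow_mul_sq_scale_le j k

theorem lilNorm_eq (n : ℕ) : lilNorm n = Real.sqrt (2 * n * llog n) := rfl

theorem sq_lilNorm (n : ℕ) : lilNorm n ^ 2 = 2 * n * llog n :=
  Real.sq_sqrt (mul_nonneg (by positivity) (llog_pos _).le)

theorem lilNorm_nonneg (n : ℕ) : 0 ≤ lilNorm n := Real.sqrt_nonneg _

theorem scale_le_lilNorm {i : ℕ} (hi : 1 ≤ i) (j : ℕ) : scale j ≤ lilNorm (i * 2 ^ j) := by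
  rw [lilNorm_eq, scale]
  have hi' : (1 : ℝ) ≤ i := by exact_mod_cast hi
  have h1 : (2 : ℝ) ^ j ≤ (i * 2 ^ j : ℕ) := by
    push_cast
    exact le_mul_of_one_le_left (by positivity) hi'
  have h2 := llog_mono h1
  have h3 := llog_pos (2 ^ j)
  refine Real.sqrt_le_sqrt (mul_le_mul ?_ h2 h3.le (by positivity))
  have : (0 : ℝ) ≤ (i * 2 ^ j : ℕ) := by positivity
  linarith

theorem lilNorm_le_mul {c : ℝ} (hc : 1 ≤ c) {m n : ℕ} (h : (m : ℝ) ≤ c * n) :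
    lilNorm m ≤ c * lilNorm n := by
  refine Real.sqrt_le_iff.2 ⟨mul_nonneg (by positivity) (lilNorm_nonneg n), ?_⟩
  rw [mul_pow, sq_lilNorm]
  have h1 : llog m ≤ c * llog n := (llog_mono h).trans (llog_mul_le hc n)
  have h2 := llog_pos (m : ℝ)
  change 2 * (m : ℝ) * llog m ≤ _
  calc 2 * (m : ℝ) * llog m ≤ 2 * (c * n) * (c * llog n) := by gcongr
    _ = _ := by ring

/-- The logarithm of i 2ʲ is at least j log 2, so the terms are at most (j log 2)^(-κ). -/
theorem summable_exp_neg_llog {κ : ℝ} (hκ : 1 < κ) {i : ℕ} (hi : 1 ≤ i) :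
    Summable (fun j : ℕ => Real.exp (-(κ * llog ((i * 2 ^ j : ℕ) : ℝ)))) := by
  have hl : 0 < Real.log 2 := Real.log_pos one_lt_two
  have hs : Summable (fun j : ℕ => (Real.log 2) ^ (-κ) * (j : ℝ) ^ (-κ)) :=
    (Real.summable_nat_rpow.2 (by linarith)).mul_left _
  refine Summable.of_norm_bounded_eventually_nat hs ?_
  filter_upwards [eventually_ge_atTop 1] with j hj
  have hj' : (0 : ℝ) < j := by exact_mod_cast hj
  have hi' : (1 : ℝ) ≤ i := by exact_mod_cast hi
  rw [Real.norm_eq_abs, Real.abs_exp, ← Real.mul_rpow hl.le hj'.le,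
    Real.rpow_def_of_pos (mul_pos hl hj')]
  have h1 : Real.log 2 * j ≤ plog ((i * 2 ^ j : ℕ) : ℝ) := by
    rw [mul_comm, ← Real.log_pow]
    refine Real.log_le_log (by positivity) (le_max_of_le_right ?_)
    push_cast
    exact le_mul_of_one_le_left (by positivity) hi'
  have h2 : Real.log (Real.log 2 * j) ≤ llog ((i * 2 ^ j : ℕ) : ℝ) :=
    Real.log_le_log (mul_pos hl hj') (h1.trans (le_max_right _ _))
  refine Real.exp_le_exp.2 ?_
  nlinarith

end Scales

/-! ### From the Choquet integral to dyadic tail sums. -/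

section Choquet

namespace SubLinSpace

variable {Ω : Type*} [MeasurableSpace Ω] {S : SubLinSpace Ω} {V : Set Ω → ℝ}

/-- Cauchy condensation: on the interval (κ2ʲ/2, κ2ʲ] the tail is at least its value at the right
end. Only monotonicity of `V` is needed. -/
theorem IsUpperCapacity.summable_of_choquet (hV : S.IsUpperCapacity V) {X : Ω → ℝ}
    (hXm : Measurable X) (hX : ∀ ω, 0 ≤ X ω) (h : choquet V X < ⊤) {κ : ℝ} (hκ : 0 < κ) :
    Summable (fun j : ℕ => 2 ^ j * V {ω | κ * 2 ^ j ≤ X ω}) := by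
  have hm : ∀ t, MeasurableSet {ω | t ≤ X ω} := fun t => measurableSet_le measurable_const hXm
  have h0 : ∫⁻ t in Set.Iio (0 : ℝ), ENNReal.ofReal (1 - V {ω | t ≤ X ω}) = 0 := by
    rw [setLIntegral_congr_fun (g := fun _ => 0) measurableSet_Iio]
    · simp
    · intro t ht
      have : {ω | t ≤ X ω} = Set.univ :=
        Set.eq_univ_of_forall fun ω => (le_of_lt ht).trans (hX ω)
      simp [this, hV.univ]
  have hI : ∫⁻ t in Set.Ioi (0 : ℝ), ENNReal.ofReal (V {ω | t ≤ X ω}) ≠ ⊤ := by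
    intro hI
    rw [choquet, h0, hI] at h
    simp at h
  set a : ℕ → ℝ := fun j => κ * 2 ^ j / 2 with ha
  have hamono : Monotone a := fun i j hij => by
    simp only [ha]
    gcongr
    exact one_le_two
  have ha1 : ∀ j, a (j + 1) = κ * 2 ^ j := fun j => by simp only [ha, pow_succ]; ring
  have hpart : ∀ j, ENNReal.ofReal (κ / 2) * ENNReal.ofReal (2 ^ j * V {ω | κ * 2 ^ j ≤ X ω}) ≤
      ∫⁻ t in Set.Ioc (a j) (a (j + 1)), ENNReal.ofReal (V {ω | t ≤ X ω}) := by
    intro j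
    calc _ = ∫⁻ _ in Set.Ioc (a j) (a (j + 1)), ENNReal.ofReal (V {ω | κ * 2 ^ j ≤ X ω}) := by
          rw [setLIntegral_const, Real.volume_Ioc, ha1, ← ENNReal.ofReal_mul (by positivity),
            ← ENNReal.ofReal_mul (hV.nonneg _ (hm _))]
          congr 1
          simp only [ha]
          ring
      _ ≤ _ := by
          refine setLIntegral_mono' measurableSet_Ioc fun t ht => ?_
          refine ENNReal.ofReal_le_ofReal (hV.mono _ _ (hm _) (hm _) fun ω hω => ?_)
          exact (ht.2.trans (ha1 j).le).trans hω
  have hsum : ∑' j, ENNReal.ofReal (κ / 2) *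
      ENNReal.ofReal (2 ^ j * V {ω | κ * 2 ^ j ≤ X ω}) ≠ ⊤ := by
    refine ne_top_of_le_ne_top hI ((ENNReal.tsum_le_tsum hpart).trans ?_)
    refine (lintegral_iUnion (fun _ => measurableSet_Ioc)
      hamono.pairwise_disjoint_on_Ioc_succ _).symm.trans_le ?_
    refine lintegral_mono_set (Set.iUnion_subset fun j t ht => ?_)
    have : 0 < a j := by positivity
    exact this.trans ht.1
  rw [ENNReal.tsum_mul_left] at hsum
  have hne : ENNReal.ofReal (κ / 2) ≠ 0 := by simpa using hκ
  have h2 : ∑' j, ENNReal.ofReal (2 ^ j * V {ω | κ * 2 ^ j ≤ X ω}) ≠ ⊤ := fun h2 =>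
    hsum (by rw [h2, ENNReal.mul_top hne])
  refine (ENNReal.summable_toReal h2).congr fun j => ?_
  rw [ENNReal.toReal_ofReal (mul_nonneg (by positivity) (hV.nonneg _ (hm _)))]

theorem measurable_plog : Measurable plog :=
  Real.measurable_log.comp (measurable_const.max measurable_id)

/-- The Choquet moment condition in the form in which it is used. -/
theorem IsUpperCapacity.summable_tail (hV : S.IsUpperCapacity V) {X : Ω → ℝ}
    (hXm : Measurable X) (h : choquet V (fun ω => X ω ^ 2 / plog (plog |X ω|)) < ⊤)
    {c : ℝ} (hc : 0 < c) :
    Summable (fun j : ℕ => 2 ^ j * V {ω | c * scale j ≤ |X ω|}) := by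
  have hXa : Measurable (fun ω => |X ω|) := hXm.abs
  have hG : Measurable (fun ω => X ω ^ 2 / plog (plog |X ω|)) :=
    (hXm.pow_const 2).div (measurable_plog.comp (measurable_plog.comp hXa))
  have hm : ∀ j, MeasurableSet {ω | c * scale j ≤ |X ω|} := fun t =>
    measurableSet_le measurable_const hXa
  have hC : 1 ≤ max c 1 := le_max_right _ _
  have hκ : 0 < c ^ 2 / max c 1 := by positivity
  have hs := hV.summable_of_choquet hG
    (fun ω => div_nonneg (sq_nonneg _) (llog_pos _).le) h hκ
  refine Summable.of_nonneg_of_le (fun j => mul_nonneg (by positivity) (hV.nonneg _ (hm j)))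
    (fun j => ?_) hs
  refine mul_le_mul_of_nonneg_left (hV.mono _ _ (hm j)
    (measurableSet_le measurable_const hG) fun ω hω => ?_) (by positivity)
  have hω' : c * scale j ≤ |X ω| := hω
  have hs0 := scale_pos j
  set u := c * scale j with hu
  have hu0 : 0 < u := mul_pos hc hs0
  have hr : 1 ≤ |X ω| / u := (one_le_div hu0).2 hω'
  -- One of the two factors |X| pays for the growth of `llog` beyond `u`, so no monotonicity of x² /
  -- `llog x` is needed.
  have h1 : llog |X ω| ≤ |X ω| / u * llog u := by
    have := llog_mul_le hr u
    rwa [div_mul_cancel₀ _ hu0.ne'] at this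
  have h2 : llog u ≤ max c 1 * llog (2 ^ j) := by
    refine le_trans (llog_mono ?_) (llog_mul_le hC _)
    exact mul_le_mul (le_max_left _ _) (scale_le_two_pow j) hs0.le (by positivity)
  change c ^ 2 / max c 1 * 2 ^ j ≤ X ω ^ 2 / llog |X ω|
  rw [le_div_iff₀ (llog_pos _)]
  have hX0 : 0 ≤ |X ω| := abs_nonneg _
  calc c ^ 2 / max c 1 * 2 ^ j * llog |X ω|
      ≤ c ^ 2 / max c 1 * 2 ^ j * (|X ω| / u * (max c 1 * llog (2 ^ j))) := by
        gcongr
        exact h1.trans (by gcongr)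
    _ = |X ω| / u * (c ^ 2 * (2 ^ j * llog (2 ^ j))) := by field_simp
    _ = |X ω| / u * u ^ 2 := by rw [← sq_scale, hu]; ring
    _ = |X ω| * u := by field_simp
    _ ≤ |X ω| * |X ω| := by gcongr
    _ = X ω ^ 2 := by rw [← sq, sq_abs]

end SubLinSpace

end Choquet

/-! ### Dyadic tails, third moments and truncated means. -/

section Tails

/-- A Lipschitz cutoff: `0` for `|z| ≤ d / 2` and `1` for `|z| ≥ d`. -/
noncomputable def cutAt (d z : ℝ) : ℝ := max 0 (min 1 (2 / d * |z| - 1))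

theorem cutAt_nonneg (d z : ℝ) : 0 ≤ cutAt d z := le_max_left _ _

theorem cutAt_le_one (d z : ℝ) : cutAt d z ≤ 1 := max_le zero_le_one (min_le_left _ _)

theorem cutAt_eq_one {d z : ℝ} (hd : 0 < d) (h : d ≤ |z|) : cutAt d z = 1 := by
  have : 1 ≤ 2 / d * |z| - 1 := by
    have h1 : 2 ≤ 2 / d * |z| := by
      rw [div_mul_eq_mul_div, le_div_iff₀ hd]
      linarith
    linarith
  rw [cutAt, min_eq_left this, max_eq_right zero_le_one]

theorem cutAt_eq_zero {d z : ℝ} (hd : 0 < d) (h : |z| ≤ d / 2) : cutAt d z = 0 := by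
  have : 2 / d * |z| - 1 ≤ 0 := by
    have h1 : 2 / d * |z| ≤ 1 := by
      rw [div_mul_eq_mul_div, div_le_iff₀ hd]
      linarith
    linarith
  exact max_eq_left ((min_le_right _ _).trans this)

theorem bddLip_clamp {F : Type*} [SeminormedAddCommGroup F] {f : F → ℝ} {K : NNReal}
    (hf : LipschitzWith K f) (r c : ℝ) : BddLip (fun x => max 0 (min 1 (r * f x - c))) := by
  have h1 := (lipschitzWith_const_mul hf r).sub (LipschitzWith.const c)
  refine BddLip.of_lipschitzWith (M := 1) ((h1.const_min 1).const_max 0) fun x => ?_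
  rw [abs_of_nonneg (le_max_left _ _)]
  exact max_le zero_le_one (min_le_left _ _)

theorem bddLip_cutAt (d : ℝ) : BddLip (cutAt d) :=
  bddLip_clamp (f := fun z : ℝ => |z|) (K := 1)
    (LipschitzWith.of_dist_le_mul fun x y => by
      simpa [Real.dist_eq] using abs_abs_sub_abs_le_abs_sub x y) _ _

/-- A layer decomposition: once |z| passes level `K`, the cutoff there is 1 and its summand alone
pays for the whole next level. -/
theorem min_pow_le_add_sum_cutAt {c : ℝ} (hc : 0 < c) {q : ℕ} (z : ℝ) {J K : ℕ}
    (h : J ≤ K) : (min |z| (c * scale K)) ^ q ≤ (min |z| (c * scale J)) ^ q +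
      ∑ j ∈ Finset.Ico J K, (c * scale (j + 1)) ^ q * cutAt (c * scale j) z := by
  induction K, h using Nat.le_induction with
  | base => simp
  | succ K hJK ih =>
    rw [Finset.sum_Ico_succ_top hJK, ← add_assoc]
    have hp : ∀ j, 0 < c * scale j := fun j => mul_pos hc (scale_pos j)
    have hm : ∀ j, 0 ≤ min |z| (c * scale j) := fun j => le_min (abs_nonneg _) (hp j).le
    rcases le_total (c * scale K) |z| with hz | hz
    · rw [cutAt_eq_one (hp K) hz, mul_one]
      have h1 : (min |z| (c * scale (K + 1))) ^ q ≤ (c * scale (K + 1)) ^ q :=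
        pow_le_pow_left₀ (hm _) (min_le_right _ _) q
      have h2 : 0 ≤ (min |z| (c * scale K)) ^ q := pow_nonneg (hm K) q
      linarith
    · have h1 : c * scale K ≤ c * scale (K + 1) :=
        mul_le_mul_of_nonneg_left (scale_mono K.le_succ) hc.le
      rw [min_eq_left (hz.trans h1)]
      rw [min_eq_left hz] at ih
      have := mul_nonneg (pow_nonneg (hp (K + 1)).le q) (cutAt_nonneg (c * scale K) z)
      linarith

theorem abs_trunc_sub_trunc {y d : ℝ} (hy : 0 ≤ y) (hyd : y ≤ d) (z : ℝ) :
    |max (-d) (min z d) - max (-y) (min z y)| = min |z| d - min |z| y := by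
  have key : ∀ z : ℝ, 0 ≤ z →
      |max (-d) (min z d) - max (-y) (min z y)| = min |z| d - min |z| y := by
    intro z hz
    have hd := hy.trans hyd
    rw [abs_of_nonneg hz, max_eq_right ((neg_nonpos.2 hd).trans (le_min hz hd)),
      max_eq_right ((neg_nonpos.2 hy).trans (le_min hz hy)), abs_of_nonneg]
    exact sub_nonneg.2 (min_le_min_left _ hyd)
  rcases le_total 0 z with hz | hz
  · exact key z hz
  · have h1 := key (-z) (neg_nonneg.2 hz)
    have e : ∀ c : ℝ, 0 ≤ c → max (-c) (min (-z) c) = -max (-c) (min z c) := by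
      intro c hc
      simp only [max_def, min_def]
      split_ifs <;> linarith
    rw [e d (hy.trans hyd), e y hy, abs_neg, neg_sub_neg, abs_sub_comm] at h1
    exact h1

namespace SubLinSpace

variable {Ω : Type*} [MeasurableSpace Ω] {S : SubLinSpace Ω}

/-- `Z` has summable tails under `S` along every multiple of the dyadic scale. -/
def SummableTails (S : SubLinSpace Ω) (Z : Ω → ℝ) : Prop :=
  ∀ c : ℝ, 0 < c → Summable (fun j : ℕ => 2 ^ j * S.ev (fun ω => cutAt (c * scale j) (Z ω)))

theorem IsUpperCapacity.summableTails {V : Set Ω → ℝ} (hV : S.IsUpperCapacity V) {X : Ω → ℝ}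
    (hX : X ∈ S.H) (h : choquet V (fun ω => X ω ^ 2 / plog (plog |X ω|)) < ⊤) {Z : Ω → ℝ}
    (hZ : Z ∈ S.H) {α : ℝ} (hXZ : ∀ ω, |Z ω| ≤ |X ω| + α) : S.SummableTails Z := by
  intro c hc
  have hXm := S.measurable_of_mem X hX
  -- The cutoff is already active at half the level, and the shift by `α` eventually costs at most
  -- another quarter; hence `c / 4`.
  have hs := hV.summable_tail hXm h (show 0 < c / 4 by positivity)
  refine Summable.of_norm_bounded_eventually_nat hs ?_
  have hB : ∀ j, S.Bdd (fun ω => cutAt (c * scale j) (Z ω)) := fun j =>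
    Bdd.comp₁ (bddLip_cutAt _) hZ
  filter_upwards [(tendsto_scale.const_mul_atTop (show 0 < c / 4 by positivity)).eventually_ge_atTop
    α] with j hj
  have hp : 0 < c * scale j := mul_pos hc (scale_pos j)
  have h0 : 0 ≤ S.ev (fun ω => cutAt (c * scale j) (Z ω)) :=
    ev_nonneg (hB j) fun ω => cutAt_nonneg _ _
  rw [Real.norm_of_nonneg (mul_nonneg (by positivity) h0)]
  refine mul_le_mul_of_nonneg_left ?_ (by positivity)
  rw [← EReal.coe_le_coe_iff, (hB j).coe_ev]
  refine (hV.sandwich ⟨_, (hB j).1⟩ ⟨_, S.const_mem 1⟩ _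
    (measurableSet_le measurable_const hXm.abs) (fun ω => ?_) (fun ω => ?_)).1
  · by_cases hω : c / 4 * scale j ≤ |X ω|
    · rw [Set.indicator_of_mem (by exact hω)]
      exact cutAt_le_one _ _
    · rw [Set.indicator_of_notMem (by exact hω)]
      refine (cutAt_eq_zero hp ?_).le
      have := hXZ ω
      push Not at hω
      linarith
  · exact Set.indicator_le_self' (fun _ _ => zero_le_one) ω

variable {Z : Ω → ℝ}

/-- Splitting into layers bounds the sequence by a geometric term plus the convolution of the
summable `2 ^ j * p j` with the geometric sequence of ratio 1/√2. -/
theorem SummableTails.summable_cube (h : S.SummableTails Z) (hZ : Z ∈ S.H) {c : ℝ} (hc : 0 < c) :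
    Summable (fun J : ℕ => 2 ^ J *
      S.ev (fun ω => |max (-(c * scale J)) (min (Z ω) (c * scale J))| ^ 3) / scale J ^ 3) := by
  set p : ℕ → ℝ := fun j => S.ev (fun ω => cutAt (c * scale j) (Z ω)) with hp
  have hB : ∀ j, S.Bdd (fun ω => cutAt (c * scale j) (Z ω)) := fun j =>
    Bdd.comp₁ (bddLip_cutAt _) hZ
  have hp0 : ∀ j, 0 ≤ p j := fun j => ev_nonneg (hB j) fun ω => cutAt_nonneg _ _
  set r : ℝ := (Real.sqrt 2)⁻¹ with hr
  have hs2 : 0 < Real.sqrt 2 := by positivity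
  have hr0 : 0 ≤ r := by positivity
  have hr1 : r < 1 := inv_lt_one_of_one_lt₀ (by rw [Real.lt_sqrt zero_le_one]; norm_num)
  -- One dyadic step doubles the weight and shrinks the normalised cube by at least r³, leaving the
  -- net ratio r.
  have hr2 : 2 * r ^ 3 = r := by
    have : r ^ 2 = 1 / 2 := by rw [hr, inv_pow, Real.sq_sqrt zero_le_two]; norm_num
    rw [pow_succ, this]; ring
  have hrk : ∀ k : ℕ, 2 ^ k * (r ^ k) ^ 3 = r ^ k := fun k => by
    rw [← pow_mul, mul_comm k 3, pow_mul, ← mul_pow, hr2]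
  have hscale : ∀ j k, scale j ≤ r ^ k * scale (j + k) := fun j k => by
    rw [hr, inv_pow, inv_mul_eq_div, le_div_iff₀ (by positivity), mul_comm]
    exact sqrt_two_pow_mul_scale_le j k
  have hb0 : ∀ j, 0 ≤ 2 ^ j * p j := fun j => mul_nonneg (by positivity) (hp0 j)
  have hconv : Summable (fun J : ℕ => ∑ j ∈ Finset.range (J + 1), (2 ^ j * p j) * r ^ (J - j)) :=
    (summable_norm_sum_mul_range_of_summable_norm (h c hc).norm
      (summable_geometric_of_lt_one hr0 hr1).norm).of_norm
  have hsum := ((summable_geometric_of_lt_one hr0 hr1).mul_left (c ^ 3)).add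
    (hconv.mul_left (8 * c ^ 3))
  have hBt : ∀ J, S.Bdd (fun ω => |max (-(c * scale J)) (min (Z ω) (c * scale J))| ^ 3) :=
    fun J => Bdd.comp₁ ((BddLip.trunc _).abs.pow 3) hZ
  refine Summable.of_nonneg_of_le (fun J => div_nonneg (mul_nonneg (by positivity)
    (ev_nonneg (hBt J) fun ω => by positivity)) (pow_nonneg (scale_pos J).le 3))
    (fun J => ?_) hsum
  have hsJ := scale_pos J
  have hev : S.ev (fun ω => |max (-(c * scale J)) (min (Z ω) (c * scale J))| ^ 3) ≤
      (c * scale 0) ^ 3 + ∑ j ∈ Finset.range J, (c * scale (j + 1)) ^ 3 * p j := by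
    have hBs : ∀ j, S.Bdd (fun ω => (c * scale (j + 1)) ^ 3 * cutAt (c * scale j) (Z ω)) :=
      fun j => (hB j).const_mul _
    refine (ev_mono (hBt J) ((Bdd.const S ((c * scale 0) ^ 3)).add
      (Bdd.sum (Finset.range J) hBs)) fun ω => ?_).trans
      ((ev_const_add_le (Bdd.sum _ hBs) _).trans
        (add_le_add le_rfl ((ev_sum_le _ hBs).trans (le_of_eq ?_))))
    · rw [abs_trunc (mul_nonneg hc.le hsJ.le)]
      have h1 := min_pow_le_add_sum_cutAt hc (q := 3) (Z ω) J.zero_le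
      rw [← Finset.range_eq_Ico] at h1
      refine h1.trans (add_le_add (pow_le_pow_left₀
        (le_min (abs_nonneg _) (mul_nonneg hc.le (scale_pos 0).le)) (min_le_right _ _) 3) le_rfl)
    · refine Finset.sum_congr rfl fun j _ => ?_
      rw [ev_const_mul (hB j) (pow_nonneg (mul_nonneg hc.le (scale_pos _).le) 3)]
  rw [div_le_iff₀ (pow_pos hsJ 3)]
  have h0 : (c * scale 0) ^ 3 * 2 ^ J ≤ c ^ 3 * r ^ J * scale J ^ 3 := by
    have h1 := hscale 0 J
    rw [zero_add] at h1
    calc (c * scale 0) ^ 3 * 2 ^ J ≤ (c * (r ^ J * scale J)) ^ 3 * 2 ^ J := by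
          have := scale_pos 0
          gcongr
      _ = c ^ 3 * (2 ^ J * (r ^ J) ^ 3) * scale J ^ 3 := by ring
      _ = _ := by rw [hrk]
  have hj : ∀ j ∈ Finset.range J, 2 ^ J * ((c * scale (j + 1)) ^ 3 * p j) ≤
      8 * c ^ 3 * ((2 ^ j * p j) * r ^ (J - j)) * scale J ^ 3 := by
    intro j hjJ
    have hjJ' := (Finset.mem_range.1 hjJ).le
    have h1 := hscale j (J - j)
    rw [Nat.add_sub_cancel' hjJ'] at h1
    have h2 := scale_add_le j 1
    have h3 : scale (j + 1) ≤ 2 * (r ^ (J - j) * scale J) := by linarith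
    have h4 : (2 : ℝ) ^ J = 2 ^ j * 2 ^ (J - j) := by rw [← pow_add, Nat.add_sub_cancel' hjJ']
    have h5 := scale_pos (j + 1)
    have h6 := hp0 j
    calc 2 ^ J * ((c * scale (j + 1)) ^ 3 * p j)
        ≤ 2 ^ J * ((c * (2 * (r ^ (J - j) * scale J))) ^ 3 * p j) := by gcongr
      _ = 8 * c ^ 3 * ((2 ^ j * p j) * (2 ^ (J - j) * (r ^ (J - j)) ^ 3)) * scale J ^ 3 := by
          rw [h4]; ring
      _ = _ := by rw [hrk]
  calc 2 ^ J * S.ev (fun ω => |max (-(c * scale J)) (min (Z ω) (c * scale J))| ^ 3)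
      ≤ 2 ^ J * ((c * scale 0) ^ 3 +
          ∑ j ∈ Finset.range J, (c * scale (j + 1)) ^ 3 * p j) := by gcongr
    _ = (c * scale 0) ^ 3 * 2 ^ J +
          ∑ j ∈ Finset.range J, 2 ^ J * ((c * scale (j + 1)) ^ 3 * p j) := by
        rw [mul_add, Finset.mul_sum]; ring
    _ ≤ c ^ 3 * r ^ J * scale J ^ 3 +
          ∑ j ∈ Finset.range J, 8 * c ^ 3 * ((2 ^ j * p j) * r ^ (J - j)) * scale J ^ 3 := by
        have := Finset.sum_le_sum hj
        linarith
    _ ≤ c ^ 3 * r ^ J * scale J ^ 3 +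
          ∑ j ∈ Finset.range (J + 1), 8 * c ^ 3 * ((2 ^ j * p j) * r ^ (J - j)) * scale J ^ 3 := by
        rw [Finset.sum_range_succ]
        have := hp0 J
        have : 0 ≤ 8 * c ^ 3 * (2 ^ J * p J * r ^ (J - J)) * scale J ^ 3 := by positivity
        linarith
    _ = _ := by rw [← Finset.sum_mul, ← Finset.mul_sum]; ring

/-- The truncated mean. -/
noncomputable def truncMean (S : SubLinSpace Ω) (Z : Ω → ℝ) (d : ℝ) : ℝ :=
  S.ev (fun ω => max (-d) (min (Z ω) d))

/-- Here ε is a tail of the convergent series ∑ 2ʲ p(j). The factor `scale J / 2 ^ J` makes the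
total drift over 2ᴶ summands o(`scale J`). -/
theorem SummableTails.exists_truncMean_close (h : S.SummableTails Z) (hZ : Z ∈ S.H) {c : ℝ}
    (hc : 0 < c) : ∃ ε : ℕ → ℝ, (∀ J, 0 ≤ ε J) ∧ Tendsto ε atTop (𝓝 0) ∧
      ∀ J d, c * scale J ≤ d →
        |S.truncMean Z (c * scale J) - S.truncMean Z d| ≤ scale J / 2 ^ J * ε J := by
  set p : ℕ → ℝ := fun j => S.ev (fun ω => cutAt (c * scale j) (Z ω)) with hp
  have hB : ∀ j, S.Bdd (fun ω => cutAt (c * scale j) (Z ω)) := fun j =>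
    Bdd.comp₁ (bddLip_cutAt _) hZ
  have hp0 : ∀ j, 0 ≤ p j := fun j => ev_nonneg (hB j) fun ω => cutAt_nonneg _ _
  have hb0 : ∀ j, 0 ≤ 2 ^ j * p j := fun j => mul_nonneg (by positivity) (hp0 j)
  have hs : Summable (fun j => 2 ^ j * p j) := h c hc
  refine ⟨fun J => 2 * c * ∑' j, 2 ^ (j + J) * p (j + J),
    fun J => mul_nonneg (by positivity) (tsum_nonneg fun j => hb0 _), ?_, fun J d hd => ?_⟩
  · have := (tendsto_sum_nat_add fun j => 2 ^ j * p j).const_mul (2 * c)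
    simpa using this
  have hpos : ∀ j, 0 < c * scale j := fun j => mul_pos hc (scale_pos j)
  -- A finite `d` lies below some level `K`, so finitely many layers, hence finite sub-additivity,
  -- are enough.
  obtain ⟨K, hK⟩ := ((tendsto_scale.const_mul_atTop hc).eventually_ge_atTop d).and
    (eventually_ge_atTop J) |>.exists
  obtain ⟨hdK, hJK⟩ := hK
  have hBs : ∀ j, S.Bdd (fun ω => c * scale (j + 1) * cutAt (c * scale j) (Z ω)) :=
    fun j => (hB j).const_mul _
  have hdiff : ∀ ω, |max (-d) (min (Z ω) d) -
      max (-(c * scale J)) (min (Z ω) (c * scale J))| ≤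
      ∑ j ∈ Finset.Ico J K, c * scale (j + 1) * cutAt (c * scale j) (Z ω) := by
    intro ω
    rw [abs_trunc_sub_trunc (hpos J).le hd]
    have h1 := min_pow_le_add_sum_cutAt hc (q := 1) (Z ω) hJK
    simp only [pow_one] at h1
    have h2 : min |Z ω| d ≤ min |Z ω| (c * scale K) := min_le_min_left _ hdK
    linarith
  have hR : S.ev (fun ω => ∑ j ∈ Finset.Ico J K, c * scale (j + 1) * cutAt (c * scale j) (Z ω)) ≤
      scale J / 2 ^ J * (2 * c * ∑' j, 2 ^ (j + J) * p (j + J)) := by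
    refine (ev_sum_le _ hBs).trans ?_
    have hterm : ∀ j ∈ Finset.Ico J K,
        S.ev (fun ω => c * scale (j + 1) * cutAt (c * scale j) (Z ω)) ≤
          scale J / 2 ^ J * (2 * c) * (2 ^ j * p j) := by
      intro j hj
      have hj' := (Finset.mem_Ico.1 hj).1
      rw [ev_const_mul (hB j) (hpos _).le]
      have h1 := scale_add_le J (j + 1 - J)
      rw [Nat.add_sub_cancel' (by omega : J ≤ j + 1)] at h1
      have h2 : (2 : ℝ) ^ (j + 1 - J) = 2 * 2 ^ j / 2 ^ J := by
        rw [eq_div_iff (by positivity), ← pow_add, Nat.sub_add_cancel (by omega), pow_succ]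
        ring
      rw [h2] at h1
      have h3 := hp0 j
      calc c * scale (j + 1) * p j ≤ c * (2 * 2 ^ j / 2 ^ J * scale J) * p j := by gcongr
        _ = _ := by ring
    refine (Finset.sum_le_sum hterm).trans ?_
    rw [← Finset.mul_sum]
    have h4 : 0 ≤ scale J / 2 ^ J * (2 * c) := by
      have := scale_pos J
      positivity
    refine (mul_le_mul_of_nonneg_left ?_ h4).trans_eq (mul_assoc _ _ _)
    rw [Finset.sum_Ico_eq_sum_range]
    have hs' : Summable (fun j => 2 ^ (j + J) * p (j + J)) := (summable_nat_add_iff J).2 hs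
    simp only [add_comm J]
    exact hs'.sum_le_tsum _ fun j _ => hb0 _
  have b1 : S.Bdd (fun ω => max (-d) (min (Z ω) d)) := Bdd.comp₁ (BddLip.trunc _) hZ
  have b2 : S.Bdd (fun ω => max (-(c * scale J)) (min (Z ω) (c * scale J))) :=
    Bdd.comp₁ (BddLip.trunc _) hZ
  have b3 := Bdd.sum (Finset.Ico J K) hBs
  have e1 := ev_le_add_of_abs_sub_le b1 b2 b3 hdiff
  have e2 := ev_le_add_of_abs_sub_le b2 b1 b3 fun ω => by rw [abs_sub_comm]; exact hdiff ω
  rw [abs_le]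
  simp only [truncMean]
  constructor <;> linarith

theorem SummableTails.exists_tendsto_truncMean (h : S.SummableTails Z) (hZ : Z ∈ S.H) :
    ∃ a : ℝ, Tendsto (S.truncMean Z) atTop (𝓝 a) := by
  obtain ⟨ε, hε0, hε, hclose⟩ := h.exists_truncMean_close hZ one_pos
  refine cauchySeq_tendsto_of_complete (Metric.cauchySeq_iff.2 fun δ hδ => ?_)
  obtain ⟨J, hJ⟩ := (hε.eventually (gt_mem_nhds (show 0 < δ / 2 by positivity))).exists
  refine ⟨1 * scale J, fun m hm n hn => ?_⟩
  have hle : scale J / 2 ^ J * ε J ≤ ε J :=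
    mul_le_of_le_one_left (hε0 J) ((div_le_one (by positivity)).2 (scale_le_two_pow J))
  have h1 := hclose J m hm
  have h2 := hclose J n hn
  rw [Real.dist_eq]
  have h3 := abs_sub_le (S.truncMean Z m) (S.truncMean Z (1 * scale J)) (S.truncMean Z n)
  rw [abs_sub_comm (S.truncMean Z m) (S.truncMean Z (1 * scale J))] at h3
  linarith

/-- Truncation does not commute with the shift by `a`. For large `d` it does where |Z| ≤ `scale J`;
elsewhere the discrepancy is at most 2|a|, on a set of small capacity. -/
theorem SummableTails.eventually_truncMean_sub_le (h : S.SummableTails Z) (hZ : Z ∈ S.H) {a : ℝ}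
    (ha : Tendsto (S.truncMean Z) atTop (𝓝 a)) {δ : ℝ} (hδ : 0 < δ) :
    ∀ᶠ d in atTop, S.truncMean (fun ω => Z ω - a) d ≤ δ := by
  set p : ℕ → ℝ := fun j => S.ev (fun ω => cutAt (1 * scale j) (Z ω)) with hp
  have hB : ∀ j, S.Bdd (fun ω => cutAt (1 * scale j) (Z ω)) := fun j =>
    Bdd.comp₁ (bddLip_cutAt _) hZ
  have hp0 : ∀ j, 0 ≤ p j := fun j => ev_nonneg (hB j) fun ω => cutAt_nonneg _ _
  have hpt : Tendsto p atTop (𝓝 0) :=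
    squeeze_zero hp0 (fun j => le_mul_of_one_le_left (hp0 j) (one_le_pow₀ one_le_two))
      (h 1 one_pos).tendsto_atTop_zero
  have hpt2 : Tendsto (fun j => 2 * |a| * p j) atTop (𝓝 0) := by
    simpa using hpt.const_mul (2 * |a|)
  obtain ⟨J, hJ⟩ := (hpt2.eventually (gt_mem_nhds (show 0 < δ / 2 by positivity))).exists
  filter_upwards [ha.eventually (gt_mem_nhds (show a < a + δ / 2 by linarith)),
    eventually_ge_atTop (2 * scale J), eventually_ge_atTop (2 * |a|)] with d hd1 hd2 hd3
  have hZa : (fun ω => Z ω - a) ∈ S.H := S.H.sub_mem hZ (S.const_mem a)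
  have b1 : S.Bdd (fun ω => max (-d) (min (Z ω - a) d)) := Bdd.comp₁ (BddLip.trunc _) hZa
  have b2 : S.Bdd (fun ω => max (-d) (min (Z ω) d)) := Bdd.comp₁ (BddLip.trunc _) hZ
  have b3 := (hB J).const_mul (2 * |a|)
  have hle : ∀ ω, max (-d) (min (Z ω - a) d) ≤
      -a + (max (-d) (min (Z ω) d) + 2 * |a| * cutAt (1 * scale J) (Z ω)) := by
    intro ω
    have ha0 := abs_nonneg a
    rcases le_total (1 * scale J) |Z ω| with hz | hz
    · rw [cutAt_eq_one (by simpa using scale_pos J) hz]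
      have h1 := (lipschitzWith_trunc d).dist_le_mul (Z ω - a) (Z ω)
      rw [Real.dist_eq, Real.dist_eq, NNReal.coe_one, one_mul, sub_sub_cancel_left, abs_neg] at h1
      linarith [le_abs_self a, le_abs_self (max (-d) (min (Z ω - a) d) - max (-d) (min (Z ω) d))]
    · have h1 := abs_le.1 hz
      have h2 := abs_le.1 (le_refl |a|)
      have h3 := mul_nonneg (mul_nonneg zero_le_two ha0) (cutAt_nonneg (1 * scale J) (Z ω))
      have h4 : max (-d) (min (Z ω - a) d) = Z ω - a := by
        rw [min_eq_left (by linarith), max_eq_right (by linarith)]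
      have h5 : max (-d) (min (Z ω) d) = Z ω := by
        rw [min_eq_left (by linarith), max_eq_right (by linarith)]
      rw [h4, h5]
      linarith
  have h6 := (ev_mono b1 ((Bdd.const S (-a)).add (b2.add b3)) hle).trans
    (ev_const_add_le (b2.add b3) _)
  have h7 := ev_add_le b2 b3
  rw [ev_const_mul (hB J) (by positivity)] at h7
  simp only [truncMean] at hd1 ⊢
  linarith

end SubLinSpace

end Tails

/-! ### Block estimates, Borel-Cantelli and the one-sided law. -/

section LawOfIteratedLogarithm

namespace SubLinSpace

variable {Ω : Type*} [MeasurableSpace Ω] {S : SubLinSpace Ω} {Z : ℕ → Ω → ℝ}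

/-- The maximal inequality for truncated variables, at the level of the iterated logarithm. -/
theorem StepLaw.ev_pmax_trunc_le (hstep : S.StepLaw Z) (hZ : ∀ i, Z i ∈ S.H)
    (hid : ∀ (φ : ℝ → ℝ), BddLip φ → ∀ i, S.ev (fun ω => φ (Z i ω)) = S.ev (fun ω => φ (Z 0 ω)))
    {y m σ A L l s₀ s₁ κ : ℝ} {n : ℕ} (hy0 : 0 ≤ y) (hm0 : 0 ≤ m) (hA0 : 0 ≤ A) (hL : 0 < L)
    (hl : 0 < l) (hs₀ : 0 < s₀) (hs₁ : 0 < s₁) (hκ : 0 < κ) (hLl : L ^ 2 = 2 * n * l)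
    (hκσ : κ * σ ^ 2 ≤ s₀ ^ 2) (hy : y ≤ s₀ / 4 * L) (hnm : n * m ≤ (s₁ - s₀) * L)
    (hm : S.ev (fun ω => max (-y) (min (Z 0 ω) y)) ≤ m)
    (hvar : S.ev (fun ω => max (-y) (min (Z 0 ω) y) ^ 2) ≤ σ ^ 2)
    (hA : S.ev (fun ω => |max (-y) (min (Z 0 ω) y)| ^ 3) ≤ A)
    {ψ : ℝ → ℝ} (hψ : BddLip ψ) (hψ1 : ∀ u, ψ u ≤ 1) (hψx : ∀ u ≤ s₁ * L, ψ u = 0) :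
    S.ev (fun ω => ψ (pmax (fun z => max (-y) (min z y)) n (fun i => Z i ω))) ≤
      Real.exp 384 * (n * A / (s₀ * L) ^ 3 + Real.exp (-(κ * l))) := by
  have hsL : 0 < s₀ * L := mul_pos hs₀ hL
  have hmax : ∀ h : ℝ, 0 ≤ h → _ := fun h hh =>
    hstep.ev_pmax_le hZ hid (lipschitzWith_trunc y) (abs_trunc_le hy0) hh
      (lam := h * m + h ^ 2 * σ ^ 2 / 2 + h ^ 3 * Real.exp (h * y) * A) (by positivity)
      (ev_exp_le (hZ 0) (BddLip.trunc y) hh (abs_trunc_le hy0) hm hvar hA) hψ hψ1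
      (mul_pos hs₁ hL).le hψx n
  have hB := (hmax 0 le_rfl).1
  -- The optimisation is applied with D = 2κl, τ = nA / (s₀L)³ and exponent h = w / (s₀L). The gap
  -- `s₁ - s₀` absorbs the mean, and `y ≤ s₀ / 4 * L` turns exp(hy) into exp(w/4).
  have hκl : κ * l = 2 * (κ * l) / 2 := by ring
  rw [hκl]
  refine le_of_forall_le_exp (ev_le_const hB fun ω => hψ1 _) (by positivity)
    (by positivity) fun w hw => ?_
  have hh : 0 ≤ w / (s₀ * L) := by positivity
  refine (hmax _ hh).2.trans (Real.exp_le_exp.2 ?_)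
  set h := w / (s₀ * L) with hdef
  have hw' : h * (s₀ * L) = w := div_mul_cancel₀ _ hsL.ne'
  have h1 : -(h * (s₁ * L)) + n * (h * m) ≤ -w := by
    have := mul_le_mul_of_nonneg_left hnm hh
    nlinarith
  have h2 : n * (h ^ 2 * σ ^ 2 / 2) ≤ w ^ 2 / (2 * (2 * (κ * l))) := by
    rw [le_div_iff₀ (by positivity), ← hw']
    calc n * (h ^ 2 * σ ^ 2 / 2) * (2 * (2 * (κ * l)))
        = h ^ 2 * (κ * σ ^ 2) * (2 * n * l) := by ring
      _ ≤ h ^ 2 * s₀ ^ 2 * (2 * n * l) := by gcongr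
      _ = _ := by rw [← hLl]; ring
  have h3 : n * (h ^ 3 * Real.exp (h * y) * A) ≤
      n * A / (s₀ * L) ^ 3 * w ^ 3 * Real.exp (w / 4) := by
    have h4 : h * y ≤ w / 4 := by
      have := mul_le_mul_of_nonneg_left hy hh
      linarith
    calc n * (h ^ 3 * Real.exp (h * y) * A) ≤ n * (h ^ 3 * Real.exp (w / 4) * A) := by gcongr
      _ = _ := by rw [hdef, div_pow]; ring
  linarith

/-- Along `n = i 2ʲ` the maximal partial sums up to `n` exceed `s √(2 n log log n)` only on events
of summable capacity. -/
theorem StepLaw.exists_summable_block (hstep : S.StepLaw Z) (hZ : ∀ i, Z i ∈ S.H)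
    (hid : ∀ (φ : ℝ → ℝ), BddLip φ → ∀ i, S.ev (fun ω => φ (Z i ω)) = S.ev (fun ω => φ (Z 0 ω)))
    (htail : S.SummableTails (Z 0))
    (hmean : ∀ δ : ℝ, 0 < δ → ∀ᶠ d in atTop, S.truncMean (Z 0) d ≤ δ)
    {σ s : ℝ} (hσ : 0 ≤ σ) (hσs : σ < s)
    (hvar : ∀ d : ℝ, 0 ≤ d → S.ev (fun ω => max (-d) (min (Z 0 ω) d) ^ 2) ≤ σ ^ 2)
    {i : ℕ} (hi : 1 ≤ i) :
    ∃ ξ : ℕ → Ω → ℝ, (∀ J, S.Bdd (ξ J)) ∧ (∀ J ω, 0 ≤ ξ J ω) ∧ Summable (fun J => S.ev (ξ J)) ∧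
      ∀ J ω, ξ J ω < 1 → ∀ m ≤ i * 2 ^ J,
        ∑ l ∈ Finset.range m, Z l ω ≤ s * lilNorm (i * 2 ^ J) := by
  -- The gap between `s` and `σ` is spent in three places: `σ < s₀` gives κ > 1, `s₀ < s₁` absorbs
  -- the truncated mean, and `s₁ < s` leaves room for the ramp of `ψ`.
  obtain ⟨s₀, hσs₀, hs₀s⟩ := exists_between hσs
  obtain ⟨s₁, hs₀s₁, hs₁s⟩ := exists_between hs₀s
  have hs₀ : 0 < s₀ := hσ.trans_lt hσs₀
  have hs₁ : 0 < s₁ := hs₀.trans hs₀s₁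
  obtain ⟨κ, hκ1, hκσ⟩ : ∃ κ : ℝ, 1 < κ ∧ κ * σ ^ 2 ≤ s₀ ^ 2 := by
    rcases hσ.eq_or_lt with rfl | hσ'
    · exact ⟨2, one_lt_two, by rw [zero_pow two_ne_zero, mul_zero]; positivity⟩
    · refine ⟨s₀ ^ 2 / σ ^ 2, ?_, (div_mul_cancel₀ _ (by positivity)).le⟩
      rw [one_lt_div (by positivity)]
      gcongr
  have hc : 0 < s₀ / 4 := by positivity
  set c := s₀ / 4 with hcdef
  obtain ⟨ε, hε0, hε, hclose⟩ := htail.exists_truncMean_close (hZ 0) hc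
  set y : ℕ → ℝ := fun J => c * scale J with hydef
  have hy : ∀ J, 0 < y J := fun J => mul_pos hc (scale_pos J)
  set L : ℕ → ℝ := fun J => lilNorm (i * 2 ^ J) with hLdef
  have hDL : ∀ J, scale J ≤ L J := fun J => scale_le_lilNorm hi J
  have hL : ∀ J, 0 < L J := fun J => (scale_pos J).trans_le (hDL J)
  set ψ : ℕ → ℝ → ℝ := fun J u =>
    max 0 (min 1 (1 / ((s - s₁) * L J) * u - s₁ * L J / ((s - s₁) * L J))) with hψdef
  have hgap : ∀ J, 0 < (s - s₁) * L J := fun J => mul_pos (sub_pos.2 hs₁s) (hL J)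
  have hψ : ∀ J, BddLip (ψ J) := fun J => bddLip_clamp LipschitzWith.id _ _
  have hψ0 : ∀ J u, 0 ≤ ψ J u := fun J u => le_max_left _ _
  have hψ1 : ∀ J u, ψ J u ≤ 1 := fun J u => max_le zero_le_one (min_le_left _ _)
  have hψe : ∀ J u, 1 / ((s - s₁) * L J) * u - s₁ * L J / ((s - s₁) * L J) =
      (u - s₁ * L J) / ((s - s₁) * L J) := fun J u => by rw [sub_div]; ring
  have hψx : ∀ J, ∀ u ≤ s₁ * L J, ψ J u = 0 := fun J u hu => by
    refine max_eq_left ((min_le_right _ _).trans ?_)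
    rw [hψe]
    exact div_nonpos_of_nonpos_of_nonneg (by linarith) (hgap J).le
  have hψs : ∀ J, ∀ u, s * L J ≤ u → ψ J u = 1 := fun J u hu => by
    have : 1 ≤ 1 / ((s - s₁) * L J) * u - s₁ * L J / ((s - s₁) * L J) := by
      rw [hψe, le_div_iff₀ (hgap J)]
      linarith
    simp only [hψdef]
    rw [min_eq_left this, max_eq_right zero_le_one]
  set t : ℕ → ℝ → ℝ := fun J z => max (-y J) (min z (y J)) with htdef
  set A : ℕ → ℝ := fun J => S.ev (fun ω => |t J (Z 0 ω)| ^ 3) with hAdef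
  have hA0 : ∀ J, 0 ≤ A J := fun J =>
    ev_nonneg (Bdd.comp₁ ((BddLip.trunc (y J)).abs.pow 3) (hZ 0)) fun ω => by positivity
  have hBψ : ∀ J, S.Bdd (fun ω => ψ J (pmax (t J) (i * 2 ^ J) (fun i => Z i ω))) := by
    intro J
    -- The trivial instance `h = lam = 0` is used for membership and boundedness only.
    refine (hstep.ev_pmax_le hZ hid (lipschitzWith_trunc (y J)) (abs_trunc_le (hy J).le)
      le_rfl le_rfl ?_ (hψ J) (hψ1 J) (mul_pos hs₁ (hL J)).le (hψx J) (i * 2 ^ J)).1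
    simp [S.ev_const]
  have hBc : ∀ J l, S.Bdd (fun ω => cutAt (y J) (Z l ω)) := fun J l =>
    Bdd.comp₁ (bddLip_cutAt _) (hZ l)
  have hBsum : ∀ J, S.Bdd (fun ω => ∑ l ∈ Finset.range (i * 2 ^ J), cutAt (y J) (Z l ω)) :=
    fun J => Bdd.sum _ (hBc J)
  have hsum0 : ∀ J ω, 0 ≤ ∑ l ∈ Finset.range (i * 2 ^ J), cutAt (y J) (Z l ω) := fun J ω =>
    Finset.sum_nonneg fun l _ => cutAt_nonneg _ _
  -- If `ξ J ω < 1`, every cutoff in the sum is below 1, so no variable of the block is truncated,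
  -- and the maximum stays below `s * L J`.
  refine ⟨fun J ω => ψ J (pmax (t J) (i * 2 ^ J) (fun i => Z i ω)) +
    ∑ l ∈ Finset.range (i * 2 ^ J), cutAt (y J) (Z l ω), fun J => (hBψ J).add (hBsum J),
    fun J ω => add_nonneg (hψ0 _ _) (hsum0 J ω), ?_, ?_⟩
  · have hsummable := (((((htail.summable_cube (hZ 0) hc).mul_left (i / s₀ ^ 3)).add
      (summable_exp_neg_llog hκ1 hi)).mul_left (Real.exp 384)).add
      ((htail c hc).mul_left (i : ℝ)))
    refine Summable.of_norm_bounded_eventually_nat hsummable ?_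
    have hεi : Tendsto (fun J => i * ε J) atTop (𝓝 0) := by simpa using hε.const_mul (i : ℝ)
    filter_upwards [hεi.eventually (gt_mem_nhds (sub_pos.2 hs₀s₁))] with J hJ
    rw [Real.norm_of_nonneg (ev_nonneg ((hBψ J).add (hBsum J)) fun ω =>
      add_nonneg (hψ0 _ _) (hsum0 J ω))]
    refine (ev_add_le (hBψ J) (hBsum J)).trans (add_le_add ?_ ?_)
    · have hsJ := scale_pos J
      have hm0 : 0 ≤ scale J / 2 ^ J * ε J := mul_nonneg (by positivity) (hε0 J)
      have hnm : ((i * 2 ^ J : ℕ) : ℝ) * (scale J / 2 ^ J * ε J) ≤ (s₁ - s₀) * L J := by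
        have e : ((i * 2 ^ J : ℕ) : ℝ) * (scale J / 2 ^ J * ε J) = i * ε J * scale J := by
          push_cast; field_simp
        rw [e]
        exact mul_le_mul hJ.le (hDL J) hsJ.le (sub_pos.2 hs₀s₁).le
      have hm : S.ev (fun ω => max (-y J) (min (Z 0 ω) (y J))) ≤ scale J / 2 ^ J * ε J := by
        -- Compare with the truncated mean at a far larger level `d`, which is at most δ.
        refine le_of_forall_pos_le_add fun δ hδ => ?_
        obtain ⟨d, hd1, hd2⟩ := ((hmean δ hδ).and (eventually_ge_atTop (c * scale J))).exists
        have h1 := (abs_le.1 (hclose J d hd2)).2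
        simp only [truncMean] at h1 hd1
        linarith
      have hmain := hstep.ev_pmax_trunc_le hZ hid (hy J).le hm0 (hA0 J) (hL J)
        (llog_pos ((i * 2 ^ J : ℕ) : ℝ)) hs₀ hs₁ (zero_lt_one.trans hκ1) (sq_lilNorm _) hκσ
        (mul_le_mul_of_nonneg_left (hDL J) hc.le) hnm hm (hvar _ (hy J).le) le_rfl
        (hψ J) (hψ1 J) (hψx J)
      refine hmain.trans ?_
      gcongr
      have hAJ := hA0 J
      have hLJ := hL J
      calc ((i * 2 ^ J : ℕ) : ℝ) * A J / (s₀ * L J) ^ 3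
          ≤ ((i * 2 ^ J : ℕ) : ℝ) * A J / (s₀ * scale J) ^ 3 := by
            gcongr
            exact hDL J
        _ = i / s₀ ^ 3 * (2 ^ J * A J / scale J ^ 3) := by
            push_cast
            rw [mul_pow]
            field_simp
    · refine (ev_sum_le _ (hBc J)).trans (le_of_eq ?_)
      rw [Finset.sum_congr rfl fun l _ => hid _ (bddLip_cutAt (y J)) l, Finset.sum_const,
        Finset.card_range, nsmul_eq_mul]
      push_cast
      ring
  · intro J ω hω m hm
    have hcut : ∀ l < i * 2 ^ J, |Z l ω| < y J := by
      intro l hl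
      by_contra! hcon
      have h1 := Finset.single_le_sum (f := fun l => cutAt (y J) (Z l ω))
        (fun l _ => cutAt_nonneg _ _) (Finset.mem_range.2 hl)
      simp only [cutAt_eq_one (hy J) hcon] at h1
      linarith [hψ0 J (pmax (t J) (i * 2 ^ J) (fun i => Z i ω))]
    have hsum : ∑ l ∈ Finset.range m, Z l ω = psum (t J) m (fun i => Z i ω) := by
      refine Finset.sum_congr rfl fun l hl => ?_
      have h1 := abs_lt.1 (hcut l ((Finset.mem_range.1 hl).trans_le hm))
      simp only [htdef]
      rw [min_eq_left h1.2.le, max_eq_right h1.1.le]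
    rw [hsum]
    refine (psum_le_pmax (t J) hm _).trans ?_
    by_contra! hcon
    have h1 := hψs J _ hcon.le
    linarith [hsum0 J ω]

theorem upCap_le_ev {f : Ω → ℝ} (hf : S.Bdd f) (h0 : ∀ ω, 0 ≤ f ω) :
    S.upCap {ω | 1 ≤ f ω} ≤ (S.ev f : EReal) := by
  rw [hf.coe_ev]
  refine sInf_le ⟨⟨f, hf.1⟩, fun ω => ?_, rfl⟩
  by_cases hω : 1 ≤ f ω
  · rw [Set.indicator_of_mem (by exact hω)]; exact hω
  · rw [Set.indicator_of_notMem (by exact hω)]; exact h0 ω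

theorem upCap_empty : (S.upCap ∅).toENNReal = 0 := by
  refine EReal.toENNReal_of_nonpos ?_
  have h := upCap_le_ev (Bdd.const S 0) fun _ => le_rfl
  have e : {ω : Ω | (1 : ℝ) ≤ 0} = ∅ := Set.eq_empty_of_forall_notMem fun _ hω =>
    absurd (show (1 : ℝ) ≤ 0 from hω) (not_le.2 zero_lt_one)
  rw [e, S.ev_const] at h
  exact_mod_cast h

/-- An outer measure dominating `outerCap`. -/
noncomputable def outerCapMeasure (S : SubLinSpace Ω) : OuterMeasure Ω :=
  OuterMeasure.ofFunction (fun A => ⨅ _ : MeasurableSet A, (S.upCap A).toENNReal)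
    (le_antisymm ((iInf_le _ MeasurableSet.empty).trans_eq upCap_empty) zero_le)

/-- A non-measurable set has weight ⊤ in `outerCapMeasure`, so only measurable covers matter. The
outer measure supplies countable sub-additivity and Borel-Cantelli. -/
theorem outerCap_le_outerCapMeasure (A : Set Ω) : S.outerCap A ≤ S.outerCapMeasure A := by
  rw [outerCapMeasure, OuterMeasure.ofFunction_apply]
  refine le_iInf₂ fun B hB => ?_
  by_cases hm : ∀ n, MeasurableSet (B n)
  · refine sInf_le ⟨B, hm, hB, tsum_congr fun n => ?_⟩
    rw [iInf_pos (hm n)]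
  · push Not at hm
    obtain ⟨n, hn⟩ := hm
    refine le_top.trans (le_trans ?_ (ENNReal.le_tsum n))
    rw [iInf_neg hn]

/-- The Borel-Cantelli lemma. -/
theorem ae_eventually_lt_one {ξ : ℕ → Ω → ℝ} (hξ : ∀ J, S.Bdd (ξ J)) (h0 : ∀ J ω, 0 ≤ ξ J ω)
    (hs : Summable (fun J => S.ev (ξ J))) :
    S.outerCapMeasure {ω | ¬ ∀ᶠ J in atTop, ξ J ω < 1} = 0 := by
  have hle : ∀ J, S.outerCapMeasure {ω | 1 ≤ ξ J ω} ≤ ENNReal.ofReal (S.ev (ξ J)) := by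
    intro J
    refine (OuterMeasure.ofFunction_le _).trans ((iInf_le _ (measurableSet_le measurable_const
      (S.measurable_of_mem _ (hξ J).1))).trans ?_)
    have := EReal.toENNReal_le_toENNReal (upCap_le_ev (hξ J) (h0 J))
    simpa using this
  have hne : ∑' J, S.outerCapMeasure {ω | 1 ≤ ξ J ω} ≠ ⊤ :=
    ne_top_of_le_ne_top hs.tsum_ofReal_ne_top (ENNReal.tsum_le_tsum hle)
  have h := measure_limsup_atTop_eq_zero hne
  refine measure_mono_null (fun ω hω => ?_) h
  rw [Filter.mem_limsup_iff_frequently_mem]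
  simpa [Filter.Frequently] using hω

/-- Every large n lies between i 2ᴶ and (i + 1) 2ᴶ with N + 1 ≤ i < 2(N + 1). For each N only
finitely many multipliers occur, and the norming constants at n and at the upper end differ by a
factor of at most 1 + 1/(N + 1). -/
theorem StepLaw.outerCapMeasure_limsup (hstep : S.StepLaw Z) (hZ : ∀ i, Z i ∈ S.H)
    (hid : ∀ (φ : ℝ → ℝ), BddLip φ → ∀ i, S.ev (fun ω => φ (Z i ω)) = S.ev (fun ω => φ (Z 0 ω)))
    (htail : S.SummableTails (Z 0))
    (hmean : ∀ δ : ℝ, 0 < δ → ∀ᶠ d in atTop, S.truncMean (Z 0) d ≤ δ)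
    {σ : ℝ} (hσ : 0 ≤ σ)
    (hvar : ∀ d : ℝ, 0 ≤ d → S.ev (fun ω => max (-d) (min (Z 0 ω) d) ^ 2) ≤ σ ^ 2) :
    S.outerCapMeasure {ω | (σ : EReal) < limsup (fun n : ℕ =>
      (((∑ l ∈ Finset.range n, Z l ω) / lilNorm n : ℝ) : EReal)) atTop} = 0 := by
  -- Index `i` stands for the multiplier `i + 1`, the upper end of the interval around n.
  have hblock := fun (N : ℕ) (i : ℕ) => hstep.exists_summable_block hZ hid htail hmean hσ
    (s := σ + 1 / (N + 1 : ℝ)) (by have : (0 : ℝ) < 1 / (N + 1) := by positivity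
                                   linarith) hvar (i := i + 1) (by omega)
  choose ξ hξ h0 hs hsum using hblock
  have hnull : S.outerCapMeasure (⋃ N, ⋃ i, {ω | ¬ ∀ᶠ J in atTop, ξ N i J ω < 1}) = 0 :=
    measure_iUnion_null fun N => measure_iUnion_null fun i =>
      ae_eventually_lt_one (hξ N i) (h0 N i) (hs N i)
  refine measure_mono_null (fun ω hω => ?_) hnull
  by_contra hcon
  simp only [Set.mem_iUnion, Set.mem_ofPred_eq, not_exists, not_not] at hcon
  refine absurd (show (σ : EReal) < _ from hω) (not_lt.2 ?_)
  have hbound : ∀ N : ℕ, limsup (fun n : ℕ =>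
      (((∑ l ∈ Finset.range n, Z l ω) / lilNorm n : ℝ) : EReal)) atTop ≤
      (((σ + 1 / (N + 1 : ℝ)) * (1 + 1 / (N + 1 : ℝ)) : ℝ) : EReal) := by
    intro N
    have hN0 : (0 : ℝ) < N + 1 := by positivity
    set s := σ + 1 / (N + 1 : ℝ) with hsdef
    have hs0 : 0 ≤ s := by positivity
    have hall : ∀ᶠ J in atTop, ∀ i ∈ Finset.range (2 * (N + 1)), ξ N i J ω < 1 :=
      (Filter.eventually_all_finset _).2 fun i _ => hcon N i
    obtain ⟨J₀, hJ₀⟩ := eventually_atTop.1 hall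
    refine limsup_le_of_le (by isBoundedDefault) ?_
    filter_upwards [eventually_ge_atTop ((N + 1) * 2 ^ J₀)] with n hn
    rw [EReal.coe_le_coe_iff]
    have hn1 : N + 1 ≤ n := le_trans (Nat.le_mul_of_pos_right _ (by positivity)) hn
    -- The largest `J` with 2ᴶ (N + 1) ≤ n, which puts n / 2ᴶ in [N + 1, 2(N + 1)).
    set J := Nat.log 2 (n / (N + 1)) with hJdef
    set i := n / 2 ^ J with hidef
    have hq : n / (N + 1) ≠ 0 := (Nat.div_pos hn1 N.succ_pos).ne'
    have hJ1 : 2 ^ J * (N + 1) ≤ n :=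
      (Nat.le_div_iff_mul_le N.succ_pos).1 (Nat.pow_log_le_self 2 hq)
    have hJ2 : n < 2 ^ (J + 1) * (N + 1) :=
      (Nat.div_lt_iff_lt_mul N.succ_pos).1 (Nat.lt_pow_succ_log_self one_lt_two _)
    have hJJ : J₀ ≤ J := by
      refine Nat.le_log_of_pow_le one_lt_two ((Nat.le_div_iff_mul_le N.succ_pos).2 ?_)
      rwa [mul_comm]
    have hpow : 0 < 2 ^ J := by positivity
    have hi1 : N + 1 ≤ i := (Nat.le_div_iff_mul_le hpow).2 (by rwa [mul_comm])
    have hi2 : i < 2 * (N + 1) := (Nat.div_lt_iff_lt_mul hpow).2 (by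
      rw [pow_succ] at hJ2; linarith)
    have hni : i * 2 ^ J ≤ n := Nat.div_mul_le_self n _
    have hni' : n ≤ (i + 1) * 2 ^ J := by
      have := Nat.lt_div_mul_add (a := n) hpow
      rw [← hidef] at this
      linarith
    have hS := hsum N i J ω (hJ₀ J hJJ i (Finset.mem_range.2 hi2)) n hni'
    have hLn : lilNorm ((i + 1) * 2 ^ J) ≤ (1 + 1 / (N + 1 : ℝ)) * lilNorm n := by
      refine lilNorm_le_mul (le_add_of_nonneg_right (by positivity)) ?_
      have h1 : ((i * 2 ^ J : ℕ) : ℝ) ≤ n := by exact_mod_cast hni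
      have h2 : ((N + 1 : ℕ) : ℝ) ≤ i := by exact_mod_cast hi1
      have h3 : (2 : ℝ) ^ J ≤ 1 / (N + 1 : ℝ) * n := by
        rw [one_div, inv_mul_eq_div, le_div_iff₀ hN0]
        have h4 : ((2 ^ J * (N + 1) : ℕ) : ℝ) ≤ n := by exact_mod_cast hJ1
        push_cast at h4
        exact h4
      push_cast at h1 ⊢
      linarith
    refine div_le_of_le_mul₀ (lilNorm_nonneg n) (by positivity) (hS.trans ?_)
    rw [mul_assoc]
    exact mul_le_mul_of_nonneg_left hLn hs0
  have hlim : Tendsto (fun N : ℕ => (((σ + 1 / (N + 1 : ℝ)) * (1 + 1 / (N + 1 : ℝ)) : ℝ) : EReal))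
      atTop (𝓝 (σ : EReal)) := by
    refine EReal.tendsto_coe.2 ?_
    have h1 := tendsto_one_div_add_atTop_nhds_zero_nat (𝕜 := ℝ)
    simpa using (h1.const_add σ).mul (h1.const_add 1)
  exact ge_of_tendsto' hlim hbound

theorem trunc_sq {d : ℝ} (hd : 0 ≤ d) (z : ℝ) :
    max (-d) (min z d) ^ 2 = min (z ^ 2) (d ^ 2) := by
  rw [← sq_abs, abs_trunc hd, ← sq_abs z]
  rcases le_total |z| d with h | h
  · rw [min_eq_left h, min_eq_left (pow_le_pow_left₀ (abs_nonneg z) h 2)]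
  · rw [min_eq_right h, min_eq_right (pow_le_pow_left₀ hd h 2)]

/-- The truncated means of a nonnegative variable increase to their limit. -/
theorem exists_hasTruncMean_of_nonneg (X : S.H) (h0 : ∀ ω, 0 ≤ (X : Ω → ℝ) ω) :
    ∃ σ : ℝ≥0∞, S.HasTruncMean X ((σ ^ 2 : ℝ≥0∞) : EReal) ∧
      ∀ c : ℝ, 0 ≤ c → S.E (S.trunc c X) ≤ ((σ ^ 2 : ℝ≥0∞) : EReal) := by
  -- For negative `c` the truncation is the constant `-c`, which decreases in `c`; hence `max c 0`.
  have hmono : Monotone (fun c : ℝ => S.E (S.trunc (max c 0) X)) := by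
    intro c d hcd
    refine S.mono _ _ fun ω => ?_
    change max (-(max c 0)) (min ((X : Ω → ℝ) ω) (max c 0)) ≤
      max (-(max d 0)) (min ((X : Ω → ℝ) ω) (max d 0))
    have hX := h0 ω
    have e : ∀ c : ℝ, max (-(max c 0)) (min ((X : Ω → ℝ) ω) (max c 0)) =
        min ((X : Ω → ℝ) ω) (max c 0) := fun c =>
      max_eq_right ((neg_nonpos.2 (le_max_right c 0)).trans (le_min hX (le_max_right c 0)))
    rw [e, e]
    exact min_le_min_left _ (max_le_max_right 0 hcd)
  set l := ⨆ c : ℝ, S.E (S.trunc (max c 0) X) with hl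
  have hl0 : 0 ≤ l := by
    refine le_trans (le_of_eq ?_) (le_iSup _ (0 : ℝ))
    rw [S.const _ 0 fun ω => ?_, EReal.coe_zero]
    change max (-(max (0 : ℝ) 0)) (min ((X : Ω → ℝ) ω) (max 0 0)) = 0
    simp [h0 ω]
  have hσ : (((l.toENNReal ^ (1 / 2 : ℝ)) ^ 2 : ℝ≥0∞) : EReal) = l := by
    rw [← ENNReal.rpow_natCast, ← ENNReal.rpow_mul]
    norm_num
    exact EReal.coe_toENNReal hl0
  refine ⟨l.toENNReal ^ (1 / 2 : ℝ), ?_, fun c hc => ?_⟩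
  · rw [hσ]
    refine (tendsto_atTop_iSup hmono).congr' ?_
    filter_upwards [eventually_ge_atTop 0] with c hc
    rw [max_eq_left hc]
  · rw [hσ]
    have := le_iSup (fun c : ℝ => S.E (S.trunc (max c 0) X)) c
    rwa [max_eq_left hc] at this

theorem IdentDistrib.ev_eq {X Z : S.H} (h : S.IdentDistrib X Z) {φ : ℝ → ℝ} (hφ : BddLip φ) :
    S.ev (fun ω => φ ((X : Ω → ℝ) ω)) = S.ev (fun ω => φ ((Z : Ω → ℝ) ω)) := by
  rw [← EReal.coe_eq_coe_iff, (Bdd.comp₁ hφ X.2).coe_ev, (Bdd.comp₁ hφ Z.2).coe_ev]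
  exact h φ hφ

/-- The one-sided law of the iterated logarithm. -/
theorem StepLaw.exists_lil {X : ℕ → S.H} (hstep : S.StepLaw (fun i => (X i : Ω → ℝ)))
    (hid : ∀ (φ : ℝ → ℝ), BddLip φ → ∀ i,
      S.ev (fun ω => φ ((X i : Ω → ℝ) ω)) = S.ev (fun ω => φ ((X 0 : Ω → ℝ) ω)))
    {V : Set Ω → ℝ} (hV : S.IsUpperCapacity V)
    (hmom : choquet V (fun ω => (X 0 : Ω → ℝ) ω ^ 2 / plog (plog |(X 0 : Ω → ℝ) ω|)) < ⊤) :
    ∃ (a : ℝ) (σ : ℝ≥0∞), (∀ i, S.HasTruncMean (X i) (a : EReal)) ∧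
      S.HasTruncMean (S.subSq a (X 0)) ((σ ^ 2 : ℝ≥0∞) : EReal) ∧
      S.outerCapMeasure {ω | (σ : EReal) < limsup (fun n : ℕ =>
        (((∑ i ∈ Finset.range n, ((X i : Ω → ℝ) ω - a)) / lilNorm n : ℝ) : EReal)) atTop} = 0 := by
  have hX : ∀ i, (X i : Ω → ℝ) ∈ S.H := fun i => (X i).2
  have htail0 : S.SummableTails (X 0 : Ω → ℝ) :=
    hV.summableTails (hX 0) hmom (hX 0) (α := 0) fun ω => by simp
  obtain ⟨a, ha⟩ := htail0.exists_tendsto_truncMean (hX 0)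
  obtain ⟨σ, hσ, hσle⟩ := exists_hasTruncMean_of_nonneg (S.subSq a (X 0)) fun ω => sq_nonneg _
  refine ⟨a, σ, fun i => ?_, hσ, ?_⟩
  · refine (EReal.tendsto_coe.2 ha).congr fun c => ?_
    rw [truncMean, ← hid _ (BddLip.trunc c) i, (Bdd.comp₁ (BddLip.trunc c) (hX i)).coe_ev]
    rfl
  rcases eq_or_ne σ ⊤ with rfl | hσtop
  · simp
  have hZ : ∀ i, (fun ω => (X i : Ω → ℝ) ω - a) ∈ S.H := fun i =>
    S.H.sub_mem (hX i) (S.const_mem a)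
  have hlip : LipschitzWith (1 + 0) (fun x : ℝ => x - a) :=
    LipschitzWith.id.sub (LipschitzWith.const a)
  have hvar : ∀ d : ℝ, 0 ≤ d →
      S.ev (fun ω => max (-d) (min ((X 0 : Ω → ℝ) ω - a) d) ^ 2) ≤ σ.toReal ^ 2 := by
    intro d hd
    -- Truncating at `d` and then squaring is the same as truncating the square at `d ^ 2`.
    have h1 := hσle (d ^ 2) (sq_nonneg d)
    have hB := Bdd.comp₁ (S := S) ((BddLip.trunc d).pow 2) (hZ 0)
    rw [← EReal.coe_le_coe_iff, hB.coe_ev]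
    have e1 : ((σ ^ 2 : ℝ≥0∞) : EReal) = ((σ.toReal ^ 2 : ℝ) : EReal) := by
      rw [← ENNReal.toReal_pow, EReal.coe_ennreal_toReal (ENNReal.pow_ne_top hσtop)]
    rw [← e1]
    convert h1 using 2
    refine Subtype.ext (funext fun ω => ?_)
    change max (-d) (min ((X 0 : Ω → ℝ) ω - a) d) ^ 2 =
      max (-d ^ 2) (min (((X 0 : Ω → ℝ) ω - a) ^ 2) (d ^ 2))
    rw [trunc_sq hd, max_eq_right]
    exact (neg_nonpos.2 (sq_nonneg d)).trans (le_min (sq_nonneg _) (sq_nonneg d))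
  have hmain := StepLaw.outerCapMeasure_limsup (Z := fun i ω => (X i : Ω → ℝ) ω - a)
    (hstep.comp hlip) hZ (fun φ hφ i => hid _ (hφ.comp hlip) i)
    (hV.summableTails (hX 0) hmom (hZ 0) (α := |a|) fun ω => abs_sub _ _)
    (fun δ hδ => htail0.eventually_truncMean_sub_le (hX 0) ha hδ) ENNReal.toReal_nonneg hvar
  rwa [EReal.coe_ennreal_toReal hσtop] at hmain

end SubLinSpace

end LawOfIteratedLogarithm

/-! ### The two-sided theorem. -/

/-- In the conclusion `a = Ĕ[Y₁] = Ĕ[Yᵢ]`, `b = Ĕ[-Y₁] = Ĕ[-Yᵢ]`, `σ₂² = Ĕ[(Y₁ - Ĕ[Y₁])²]` and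
`σ₁² = Ĕ[(Y₁ + Ĕ[-Y₁])²]`; these are limits, so they are unique. -/
theorem mainTheorem12 {Ω : Type*} [MeasurableSpace Ω] (S : SubLinSpace Ω)
    (V : Set Ω → ℝ) (hV : S.IsUpperCapacity V)
    (Y : ℕ → S.H) (hindep : S.IndepSeq Y) (hid : ∀ i, S.IdentDistrib (Y i) (Y 0))
    (hmom : choquet V (fun ω => (Y 0 : Ω → ℝ) ω ^ 2 / plog (plog |(Y 0 : Ω → ℝ) ω|)) < ⊤) :
    ∃ (a b : ℝ) (σ₁ σ₂ : ℝ≥0∞),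
      (∀ i, S.HasTruncMean (Y i) (a : EReal)) ∧
      (∀ i, S.HasTruncMean (-Y i) (b : EReal)) ∧
      S.HasTruncMean (S.subSq (-b) (Y 0)) ((σ₁ ^ 2 : ℝ≥0∞) : EReal) ∧
      S.HasTruncMean (S.subSq a (Y 0)) ((σ₂ ^ 2 : ℝ≥0∞) : EReal) ∧
      S.outerCap {ω |
        liminf (fun n : ℕ =>
          (((∑ i ∈ Finset.range n, ((Y i : Ω → ℝ) ω + b)) / lilNorm n : ℝ) : EReal)) atTop
            < -(σ₁ : EReal) ∨
        (σ₂ : EReal) < limsup (fun n : ℕ =>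
          (((∑ i ∈ Finset.range n, ((Y i : Ω → ℝ) ω - a)) / lilNorm n : ℝ) : EReal)) atTop} = 0 := by
  have hid' : ∀ (φ : ℝ → ℝ), BddLip φ → ∀ i,
      S.ev (fun ω => φ ((Y i : Ω → ℝ) ω)) = S.ev (fun ω => φ ((Y 0 : Ω → ℝ) ω)) :=
    fun φ hφ i => (hid i).ev_eq hφ
  have hneg : LipschitzWith 1 (fun x : ℝ => -x) := LipschitzWith.id.neg
  -- The moment condition is even in `Y`, so the one-sided law applies to `-Y`; its limsup is minus
  -- the liminf in question.
  have hlow := SubLinSpace.StepLaw.exists_lil (X := fun i => -Y i)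
    (hindep.stepLaw.comp hneg) (fun φ hφ i => hid' _ (hφ.comp hneg) i) hV (by simpa using hmom)
  obtain ⟨a, σ₂, ha, hσ₂, hnull₂⟩ := hindep.stepLaw.exists_lil hid' hV hmom
  obtain ⟨b, σ₁, hb, hσ₁, hnull₁⟩ := hlow
  refine ⟨a, b, σ₁, σ₂, ha, hb, ?_, hσ₂, ?_⟩
  · convert hσ₁ using 1
    refine Subtype.ext (funext fun ω => ?_)
    change ((Y 0 : Ω → ℝ) ω - -b) ^ 2 = (-(Y 0 : Ω → ℝ) ω - b) ^ 2
    ring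
  · refine le_antisymm ((SubLinSpace.outerCap_le_outerCapMeasure _).trans ?_) zero_le
    rw [Set.ofPred_or]
    refine (measure_union_null (measure_mono_null (fun ω hω => ?_) hnull₁) hnull₂).le
    have hω' : liminf (fun n : ℕ =>
        (((∑ i ∈ Finset.range n, ((Y i : Ω → ℝ) ω + b)) / lilNorm n : ℝ) : EReal)) atTop
          < -(σ₁ : EReal) := hω
    have e : (fun n : ℕ => (((∑ i ∈ Finset.range n,
        ((↑(-Y i) : Ω → ℝ) ω - b)) / lilNorm n : ℝ) : EReal)) = -(fun n : ℕ =>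
        (((∑ i ∈ Finset.range n, ((Y i : Ω → ℝ) ω + b)) / lilNorm n : ℝ) : EReal)) := by
      funext n
      rw [Pi.neg_apply, ← EReal.coe_neg, ← neg_div, ← Finset.sum_neg_distrib]
      congr 2
      refine Finset.sum_congr rfl fun i _ => ?_
      change -(Y i : Ω → ℝ) ω - b = _
      ring
    rw [Set.mem_ofPred_eq, e, EReal.limsup_neg]
    rw [EReal.lt_neg_comm]
    exact hω'
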